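/- **Setting.** Let $\Omega\subseteq\mathbb R^3$ be open, $T>0$, and let $\mathbb V=\mathbb R^3$, and let $\mathbb T$, $\mathbb S$ be the spaces of trace-free and of symmetric real $3\times3$ matrices with the Frobenius inner product. Put $$X=L^2(\Omega,\mathbb V)\oplus L^2(\Omega,\mathbb T)\oplus L^2(\Omega,\mathbb S)\oplus L^2(\Omega,\mathbb R).$$ Differential operators act column-wise: $(\operatorname{grad}v)_{ij}=\partial_iv_j$, $(\operatorname{curl}M)_{ij}=\sum_{k,l}\varepsilon_{ikl}\partial_kM_{lj}$, $(\operatorname{div}M)_j=\sum_i\partial_iM_{ij}$; $\operatorname{dev}M=M-\frac13\operatorname{tr}(M)I$, $\operatorname{sym}M=\frac12(M+M^\top)$ and $SM=M^\top-\operatorname{tr}(M)I$. Let $d$ be the unbounded operator on $X$ $$d(u_0,u_1,u_2,u_3)=(0,\ \operatorname{dev}\operatorname{grad}u_0,\ \operatorname{sym}\operatorname{curl}u_1,\ \operatorname{div}\operatorname{div}u_2)$$ with derivatives in the sense of distributions on $\Omega$ and with domain $D(d)=H(\operatorname{dev}\operatorname{grad};\mathbb V)\oplus H(\operatorname{sym}\operatorname{curl};\mathbb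 T)\oplus H(\operatorname{div}\operatorname{div};\mathbb S)\oplus L^2(\Omega)$, i.e. all elements of $X$ for which these derivatives are square-integrable. Let $d^*$, with domain $D(d^*)$, be its Hilbert space adjoint (it acts as $-\operatorname{div}$, $\operatorname{curl}$, $\operatorname{hess}$ on the last three components). Let $J=\operatorname{diag}(1,-1,1,-1)$ and $\mathcal L=J(d+d^*)$ with $D(\mathcal L)=D(d)\cap D(d^*)$, equipped with the graph norm. **Theorem (Well-posedness).** Assume that $D(\mathcal L)$ is dense in $X$ and let $U_0=(\lambda_0^0,A_0,S\gamma_0,\lambda_3^0)\in D(\mathcal L)$. 1. There is a unique $U=(\lambda_0,A,S\gamma,\lambda_3)\in C^0([0,T],D(\mathcal L))\cap C^1([0,T],X)$ with $\partial_tU=\mathcal LU$ on $[0,T]$ and $U(0)=U_0$. It satisfies $\|U\|_{C([0,T],X)}\le\|U_0\|_X$. 2. If moreover $\lambda_0^0=0$, $\lambda_3^0=0$, $\operatorname{div}A_0=0$ and $\operatorname{div}\operatorname{div}S\gamma_0=0$, then $\lambda_0(t)=0$ and $\lambda_3(t)=0$ for all $t\in[0,T]$, and $(A,\gamma)$ is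 the unique solution with $A(0)=A_0$, $\gamma(0)=\gamma_0$ of the reformulated ADM system $$\operatorname{div}A=0,\qquad A_t+\operatorname{curl}S\gamma=0,\qquad S\gamma_t-\operatorname{sym}\operatorname{curl}A=0,\qquad \operatorname{div}\operatorname{div}S\gamma=0\qquad\text{on }[0,T].$$ Here a solution is a pair $(A,\gamma)\in C^1([0,T],L^2(\Omega,\mathbb T))\times C^1([0,T],L^2(\Omega,\mathbb S))$ such that, at each time, $A$ lies in the domains of $\operatorname{sym}\operatorname{curl}$ and of $(\operatorname{dev}\operatorname{grad})^*$, $S\gamma$ lies in the domains of $\operatorname{div}\operatorname{div}$ and of $(\operatorname{sym}\operatorname{curl})^*$, and the equations hold with $-\operatorname{div}=(\operatorname{dev}\operatorname{grad})^*$ and $\operatorname{curl}=(\operatorname{sym}\operatorname{curl})^*$. -/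

import Mathlib

open MeasureTheory TopologicalSpace Set
open LineDeriv
open scoped Distributions LinearPMap ENNReal

noncomputable section

namespace DivDiv

/-! ### Algebra: vectors and matrices in dimension three -/

/-- Physical space `ℝ³`, and also the space `𝕍` of vectors. -/
abbrev Vec : Type := EuclideanSpace ℝ (Fin 3)

/-- `3 × 3` real matrices with the Frobenius inner product; the `(i, j)` entry of `M` is
`M (i, j)`. -/
abbrev Mat : Type := EuclideanSpace ℝ (Fin 3 × Fin 3)

/-- The space `𝕋` of trace-free matrices. -/
def TraceFree : Submodule ℝ Mat where
  carrier := {M | ∑ i, M (i, i) = 0}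
  add_mem' {M N} hM hN := by
    simp only [mem_ofPred_eq, PiLp.add_apply, Finset.sum_add_distrib] at *
    rw [hM, hN, add_zero]
  zero_mem' := by simp
  smul_mem' c M hM := by
    simp only [mem_ofPred_eq, PiLp.smul_apply, smul_eq_mul, ← Finset.mul_sum] at *
    rw [hM, mul_zero]

/-- The space `𝕊` of symmetric matrices. -/
def Symm : Submodule ℝ Mat where
  carrier := {M | ∀ i j, M (i, j) = M (j, i)}
  add_mem' {M N} hM hN i j := by simp only [PiLp.add_apply, hM i j, hN i j]
  zero_mem' i j := by simp
  smul_mem' c M hM i j := by simp only [PiLp.smul_apply, hM i j]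

instance : NormedAddCommGroup TraceFree := Submodule.normedAddCommGroup _
instance : NormedAddCommGroup Symm := Submodule.normedAddCommGroup _
instance : InnerProductSpace ℝ TraceFree := Submodule.innerProductSpace _
instance : InnerProductSpace ℝ Symm := Submodule.innerProductSpace _
instance : CompleteSpace TraceFree := FiniteDimensional.complete ℝ _
instance : CompleteSpace Symm := FiniteDimensional.complete ℝ _

/-- The algebraic operator `S M = Mᵀ - tr(M) I` on matrices. -/
def matS : Mat →ₗ[ℝ] Mat where
  toFun M := WithLp.toLp 2 fun p => M (p.2, p.1) - if p.1 = p.2 then ∑ k, M (k, k) else 0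
  map_add' M N := by
    ext p
    by_cases h : p.1 = p.2 <;> simp [h, Finset.sum_add_distrib]
    ring
  map_smul' c M := by
    ext p
    by_cases h : p.1 = p.2 <;> simp [h, ← Finset.mul_sum]
    ring

lemma matS_mem (M : Mat) (hM : M ∈ Symm) : matS M ∈ Symm := by
  intro i j
  have h := hM i j
  by_cases hij : i = j
  · subst hij; rfl
  · simp [matS, hij, Ne.symm hij, h]

/-- `S` as a continuous linear operator on symmetric matrices. -/
def symmS : Symm →L[ℝ] Symm := LinearMap.toContinuousLinearMap (matS.restrict matS_mem)

/-! ### Differential operators in the sense of distributions, acting column-wise -/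

section Distributions

variable {Ω : Opens Vec}

/-- The `i`-th vector of the standard basis. -/
abbrev e (i : Fin 3) : Vec := EuclideanSpace.single i 1

/-- `(grad v)ᵢⱼ = ∂ᵢ vⱼ`. -/
def grad (v : Fin 3 → 𝓓'(Ω, ℝ)) : Matrix (Fin 3) (Fin 3) 𝓓'(Ω, ℝ) :=
  Matrix.of fun i j => ∂_{e i} (v j)

/-- `dev M = M - (1/3) tr(M) I`. -/
def dev (M : Matrix (Fin 3) (Fin 3) 𝓓'(Ω, ℝ)) : Matrix (Fin 3) (Fin 3) 𝓓'(Ω, ℝ) :=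
  M - Matrix.diagonal fun _ => (1 / 3 : ℝ) • M.trace

/-- `(curl M)ᵢⱼ = ∑ₖₗ εᵢₖₗ ∂ₖ Mₗⱼ`; the indices are read modulo three. -/
def curl (M : Matrix (Fin 3) (Fin 3) 𝓓'(Ω, ℝ)) : Matrix (Fin 3) (Fin 3) 𝓓'(Ω, ℝ) :=
  Matrix.of fun i j => ∂_{e (i + 1)} (M (i + 2) j) - ∂_{e (i + 2)} (M (i + 1) j)

/-- `sym M = (M + Mᵀ) / 2`. -/
def sym (M : Matrix (Fin 3) (Fin 3) 𝓓'(Ω, ℝ)) : Matrix (Fin 3) (Fin 3) 𝓓'(Ω, ℝ) :=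
  (1 / 2 : ℝ) • (M + M.transpose)

/-- `(div M)ⱼ = ∑ᵢ ∂ᵢ Mᵢⱼ`. -/
def div (M : Matrix (Fin 3) (Fin 3) 𝓓'(Ω, ℝ)) : Fin 3 → 𝓓'(Ω, ℝ) :=
  fun j => ∑ i, ∂_{e i} (M i j)

/-- `divdiv M = ∑ᵢⱼ ∂ⱼ ∂ᵢ Mᵢⱼ`. -/
def divdiv (M : Matrix (Fin 3) (Fin 3) 𝓓'(Ω, ℝ)) : 𝓓'(Ω, ℝ) :=
  ∑ j, ∂_{e j} (div M j)

end Distributions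

/-! ### The `L²` spaces and the regular distributions they define -/

/-- `L²(Ω, E)`. -/
abbrev L2 (Ω : Opens Vec) (E : Type) [NormedAddCommGroup E] : Type :=
  Lp E 2 (volume.restrict (Ω : Set Vec))

section Regular

variable {Ω : Opens Vec} {E : Type} [NormedAddCommGroup E] [NormedSpace ℝ E]

lemma locInt (ℓ : E →L[ℝ] ℝ) (u : L2 Ω E) :
    LocallyIntegrableOn (fun x => ℓ (u x)) Ω (volume.restrict (Ω : Set Vec)) :=
  ((ℓ.comp_memLp' (Lp.memLp u)).locallyIntegrable (by norm_num)).locallyIntegrableOn _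

/-- The functional `φ ↦ ∫_Ω φ ℓ(u)` on test functions. -/
def regular (ℓ : E →L[ℝ] ℝ) (u : L2 Ω E) : 𝓓(Ω, ℝ) →L[ℝ] ℝ :=
  TestFunction.integralAgainstBilinCLM (ContinuousLinearMap.mul ℝ ℝ)
    (volume.restrict (Ω : Set Vec)) (fun x => ℓ (u x))

lemma regular_apply (ℓ : E →L[ℝ] ℝ) (u : L2 Ω E) (φ : 𝓓(Ω, ℝ)) :
    regular ℓ u φ = ∫ x in (Ω : Set Vec), φ x * ℓ (u x) :=
  TestFunction.integralAgainstBilinCLM_eq_integral (locInt ℓ u)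

/-- The distribution `φ ↦ ∫_Ω φ ℓ(u)` defined by the component `ℓ(u)` of `u ∈ L²(Ω, E)`. -/
def component (ℓ : E →L[ℝ] ℝ) : L2 Ω E →ₗ[ℝ] 𝓓'(Ω, ℝ) where
  toFun u := regular ℓ u
  map_add' u v := by
    ext φ
    have hu : Integrable (fun x => φ x * ℓ (u x)) (volume.restrict (Ω : Set Vec)) := (TestFunction.integrable_bilin (ContinuousLinearMap.mul ℝ ℝ) (locInt ℓ u) φ)
    have hv : Integrable (fun x => φ x * ℓ (v x)) (volume.restrict (Ω : Set Vec)) := (TestFunction.integrable_bilin (ContinuousLinearMap.mul ℝ ℝ) (locInt ℓ v) φ)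
    change regular ℓ _ φ = regular ℓ _ φ + regular ℓ _ φ
    rw [regular_apply, regular_apply, regular_apply, ← integral_add hu hv]
    apply integral_congr_ae
    filter_upwards [Lp.coeFn_add u v] with x hx
    rw [hx, Pi.add_apply, map_add, mul_add]
  map_smul' c u := by
    ext φ
    change regular ℓ _ φ = c * regular ℓ _ φ
    rw [regular_apply, regular_apply, ← integral_const_mul]
    apply integral_congr_ae
    filter_upwards [Lp.coeFn_smul c u] with x hx
    rw [hx, Pi.smul_apply, map_smul, smul_eq_mul]
    ring

end Regular

variable (Ω : Opens Vec)

/-- The components of a square-integrable vector field, as distributions. -/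
def vecDist {Ω : Opens Vec} (u : L2 Ω Vec) : Fin 3 → 𝓓'(Ω, ℝ) :=
  fun j => component (EuclideanSpace.proj j) u

/-- The entries of a square-integrable matrix field with values in `K`, as distributions. -/
def matDist {Ω : Opens Vec} {K : Submodule ℝ Mat} (M : L2 Ω K) :
    Matrix (Fin 3) (Fin 3) 𝓓'(Ω, ℝ) :=
  Matrix.of fun i j => component ((EuclideanSpace.proj (i, j)).comp K.subtypeL) M

/-- A square-integrable scalar field, as a distribution. -/
def scalDist {Ω : Opens Vec} (u : L2 Ω ℝ) : 𝓓'(Ω, ℝ) :=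
  component (ContinuousLinearMap.id ℝ ℝ) u

/-! ### The divdiv complex as unbounded operators with maximal (weak) domains -/

section Linearity

variable {Ω}

lemma vecDist_add (u v : L2 Ω Vec) : vecDist (u + v) = vecDist u + vecDist v := by
  ext1 j; exact map_add (component _) _ _

lemma vecDist_smul (c : ℝ) (u : L2 Ω Vec) : vecDist (c • u) = c • vecDist u := by
  ext1 j; exact map_smul (component _) _ _

lemma matDist_add {K : Submodule ℝ Mat} (M N : L2 Ω K) :
    matDist (M + N) = matDist M + matDist N := by
  refine Matrix.ext fun i j => ?_
  exact map_add (component ((EuclideanSpace.proj (i, j)).comp K.subtypeL)) M N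

lemma matDist_smul {K : Submodule ℝ Mat} (c : ℝ) (M : L2 Ω K) :
    matDist (c • M) = c • matDist M := by
  refine Matrix.ext fun i j => ?_
  exact map_smul (component ((EuclideanSpace.proj (i, j)).comp K.subtypeL)) c M

lemma grad_add (v w : Fin 3 → 𝓓'(Ω, ℝ)) : grad (v + w) = grad v + grad w := by
  refine Matrix.ext fun i j => ?_
  exact lineDerivOp_add (e i) (v j) (w j)

lemma grad_smul (c : ℝ) (v : Fin 3 → 𝓓'(Ω, ℝ)) : grad (c • v) = c • grad v := by
  refine Matrix.ext fun i j => ?_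
  exact lineDerivOp_smul (e i) c (v j)

lemma dev_add (M N : Matrix (Fin 3) (Fin 3) 𝓓'(Ω, ℝ)) : dev (M + N) = dev M + dev N := by
  refine Matrix.ext fun i j => ?_
  by_cases h : i = j
  · subst h
    simp only [dev, Matrix.sub_apply, Matrix.add_apply, Matrix.diagonal_apply_eq,
      Matrix.trace_add, smul_add]
    abel
  · simp [dev, h]

lemma dev_smul (c : ℝ) (M : Matrix (Fin 3) (Fin 3) 𝓓'(Ω, ℝ)) : dev (c • M) = c • dev M := by
  refine Matrix.ext fun i j => ?_
  by_cases h : i = j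
  · subst h
    simp only [dev, Matrix.sub_apply, Matrix.smul_apply, Matrix.diagonal_apply_eq,
      Matrix.trace_smul, smul_sub, smul_comm c]
  · simp [dev, h]

lemma curl_add (M N : Matrix (Fin 3) (Fin 3) 𝓓'(Ω, ℝ)) : curl (M + N) = curl M + curl N := by
  refine Matrix.ext fun i j => ?_
  simp only [curl, Matrix.of_apply, Matrix.add_apply, lineDerivOp_add]
  abel

lemma curl_smul (c : ℝ) (M : Matrix (Fin 3) (Fin 3) 𝓓'(Ω, ℝ)) : curl (c • M) = c • curl M := by
  refine Matrix.ext fun i j => ?_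
  simp only [curl, Matrix.of_apply, Matrix.smul_apply, lineDerivOp_smul, smul_sub]

lemma sym_add (M N : Matrix (Fin 3) (Fin 3) 𝓓'(Ω, ℝ)) : sym (M + N) = sym M + sym N := by
  simp only [sym, Matrix.transpose_add, ← smul_add]
  congr 1
  abel

lemma sym_smul (c : ℝ) (M : Matrix (Fin 3) (Fin 3) 𝓓'(Ω, ℝ)) : sym (c • M) = c • sym M := by
  simp only [sym, Matrix.transpose_smul, ← smul_add, smul_comm c]

lemma divdiv_add (M N : Matrix (Fin 3) (Fin 3) 𝓓'(Ω, ℝ)) :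
    divdiv (M + N) = divdiv M + divdiv N := by
  simp only [divdiv, div, Matrix.add_apply, lineDerivOp_add, Finset.sum_add_distrib]

lemma divdiv_smul (c : ℝ) (M : Matrix (Fin 3) (Fin 3) 𝓓'(Ω, ℝ)) :
    divdiv (c • M) = c • divdiv M := by
  simp only [divdiv, div, Matrix.smul_apply, lineDerivOp_smul, ← Finset.smul_sum]

lemma vecDist_zero : vecDist (0 : L2 Ω Vec) = 0 := by
  simpa only [zero_smul] using vecDist_smul (0 : ℝ) (0 : L2 Ω Vec)

lemma matDist_zero {K : Submodule ℝ Mat} : matDist (0 : L2 Ω K) = 0 := by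
  refine Matrix.ext fun i j => ?_
  exact map_zero (component ((EuclideanSpace.proj (i, j)).comp K.subtypeL))

lemma grad_zero : grad (0 : Fin 3 → 𝓓'(Ω, ℝ)) = 0 := by
  simpa only [zero_smul] using grad_smul (0 : ℝ) (0 : Fin 3 → 𝓓'(Ω, ℝ))

lemma dev_zero : dev (0 : Matrix (Fin 3) (Fin 3) 𝓓'(Ω, ℝ)) = 0 := by
  simpa only [zero_smul] using dev_smul (0 : ℝ) (0 : Matrix (Fin 3) (Fin 3) 𝓓'(Ω, ℝ))

lemma curl_zero : curl (0 : Matrix (Fin 3) (Fin 3) 𝓓'(Ω, ℝ)) = 0 := by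
  simpa only [zero_smul] using curl_smul (0 : ℝ) (0 : Matrix (Fin 3) (Fin 3) 𝓓'(Ω, ℝ))

lemma sym_zero : sym (0 : Matrix (Fin 3) (Fin 3) 𝓓'(Ω, ℝ)) = 0 := by
  simpa only [zero_smul] using sym_smul (0 : ℝ) (0 : Matrix (Fin 3) (Fin 3) 𝓓'(Ω, ℝ))

lemma divdiv_zero : divdiv (0 : Matrix (Fin 3) (Fin 3) 𝓓'(Ω, ℝ)) = 0 := by
  simpa only [zero_smul] using divdiv_smul (0 : ℝ) (0 : Matrix (Fin 3) (Fin 3) 𝓓'(Ω, ℝ))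

end Linearity

/-- The graph `{(u, f) ∈ L²(Ω, 𝕍) × L²(Ω, 𝕋) : f = dev grad u}`. -/
def devGradGraph : Submodule ℝ (L2 Ω Vec × L2 Ω TraceFree) where
  carrier := {p | matDist p.2 = dev (grad (vecDist p.1))}
  add_mem' {p q} hp hq := by
    simp only [mem_ofPred_eq, Prod.fst_add, Prod.snd_add, vecDist_add, matDist_add, grad_add, dev_add] at *
    rw [hp, hq]
  zero_mem' := by
    simp only [mem_ofPred_eq, Prod.fst_zero, Prod.snd_zero, vecDist_zero, matDist_zero, grad_zero,
      dev_zero]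
  smul_mem' c p hp := by
    simp only [mem_ofPred_eq, Prod.smul_fst, Prod.smul_snd, vecDist_smul, matDist_smul, grad_smul, dev_smul] at *
    rw [hp]

/-- The graph `{(M, f) ∈ L²(Ω, 𝕋) × L²(Ω, 𝕊) : f = sym curl M}`. -/
def symCurlGraph : Submodule ℝ (L2 Ω TraceFree × L2 Ω Symm) where
  carrier := {p | matDist p.2 = sym (curl (matDist p.1))}
  add_mem' {p q} hp hq := by
    simp only [mem_ofPred_eq, Prod.fst_add, Prod.snd_add, matDist_add, curl_add, sym_add] at *
    rw [hp, hq]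
  zero_mem' := by
    simp only [mem_ofPred_eq, Prod.fst_zero, Prod.snd_zero, matDist_zero, curl_zero, sym_zero]
  smul_mem' c p hp := by
    simp only [mem_ofPred_eq, Prod.smul_fst, Prod.smul_snd, matDist_smul, curl_smul, sym_smul] at *
    rw [hp]

/-- The graph `{(M, f) ∈ L²(Ω, 𝕊) × L²(Ω) : f = div div M}`. -/
def divDivGraph : Submodule ℝ (L2 Ω Symm × L2 Ω ℝ) where
  carrier := {p | scalDist p.2 = divdiv (matDist p.1)}
  add_mem' {p q} hp hq := by
    simp only [mem_ofPred_eq, Prod.fst_add, Prod.snd_add, scalDist, map_add, matDist_add, divdiv_add] at *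
    rw [hp, hq]
  zero_mem' := by
    simp only [mem_ofPred_eq, Prod.fst_zero, Prod.snd_zero, scalDist, map_zero, matDist_zero,
      divdiv_zero]
  smul_mem' c p hp := by
    simp only [mem_ofPred_eq, Prod.smul_fst, Prod.smul_snd, scalDist, map_smul, matDist_smul, divdiv_smul] at *
    rw [hp]

lemma component_eq_zero {E : Type} [NormedAddCommGroup E] [NormedSpace ℝ E] (ℓ : E →L[ℝ] ℝ)
    (u : L2 Ω E) (h : component ℓ u = 0) :
    ∀ᵐ x ∂(volume.restrict (Ω : Set Vec)), ℓ (u x) = 0 := by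
  have h1 := IsOpen.ae_eq_zero_of_integral_contDiff_smul_eq_zero (μ := volume.restrict (Ω : Set Vec))
    Ω.isOpen (locInt ℓ u) (fun g hg hc hs => by
      have h2 := regular_apply ℓ u (⟨g, hg, hc, hs⟩ : 𝓓(Ω, ℝ))
      have h3 : regular ℓ u (⟨g, hg, hc, hs⟩ : 𝓓(Ω, ℝ)) = 0 :=
        congrArg (fun D : 𝓓'(Ω, ℝ) => D ⟨g, hg, hc, hs⟩) h
      rw [h3] at h2
      exact h2.symm)
  filter_upwards [h1, ae_restrict_mem Ω.isOpen.measurableSet] with x hx hm using hx hm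

lemma matDist_eq_zero {K : Submodule ℝ Mat} (M : L2 Ω K) (h : matDist M = 0) : M = 0 := by
  rw [Lp.eq_zero_iff_ae_eq_zero]
  have h1 : ∀ p : Fin 3 × Fin 3, ∀ᵐ x ∂(volume.restrict (Ω : Set Vec)), (M x : Mat) p = 0 :=
    fun p => component_eq_zero Ω ((EuclideanSpace.proj p).comp K.subtypeL) M
      (congrFun (congrFun h p.1) p.2)
  filter_upwards [ae_all_iff.2 h1] with x hx
  refine Subtype.ext ?_
  ext p
  exact hx p

lemma scalDist_eq_zero (u : L2 Ω ℝ) (h : scalDist u = 0) : u = 0 := by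
  rw [Lp.eq_zero_iff_ae_eq_zero]
  exact component_eq_zero Ω (ContinuousLinearMap.id ℝ ℝ) u h

/- The three graphs are single-valued, so they are graphs of (unbounded) operators. -/

lemma devGradGraph_single (p : L2 Ω Vec × L2 Ω TraceFree) (hp : p ∈ devGradGraph Ω)
    (h : p.1 = 0) : p.2 = 0 := by
  refine matDist_eq_zero Ω _ ?_
  have hp' : matDist p.2 = dev (grad (vecDist p.1)) := hp
  rw [hp', h, vecDist_zero, grad_zero, dev_zero]

lemma symCurlGraph_single (p : L2 Ω TraceFree × L2 Ω Symm) (hp : p ∈ symCurlGraph Ω)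
    (h : p.1 = 0) : p.2 = 0 := by
  refine matDist_eq_zero Ω _ ?_
  have hp' : matDist p.2 = sym (curl (matDist p.1)) := hp
  rw [hp', h, matDist_zero, curl_zero, sym_zero]

lemma divDivGraph_single (p : L2 Ω Symm × L2 Ω ℝ) (hp : p ∈ divDivGraph Ω)
    (h : p.1 = 0) : p.2 = 0 := by
  refine scalDist_eq_zero Ω _ ?_
  have hp' : scalDist p.2 = divdiv (matDist p.1) := hp
  rw [hp', h, matDist_zero, divdiv_zero]

/-- `dev grad` as an unbounded operator, with domain
`H(dev grad; 𝕍) = {u ∈ L²(Ω, 𝕍) : dev grad u ∈ L²(Ω, 𝕋)}`. -/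
def devGrad : L2 Ω Vec →ₗ.[ℝ] L2 Ω TraceFree := (devGradGraph Ω).toLinearPMap

/-- `sym curl` as an unbounded operator, with domain
`H(sym curl; 𝕋) = {M ∈ L²(Ω, 𝕋) : sym curl M ∈ L²(Ω, 𝕊)}`. -/
def symCurl : L2 Ω TraceFree →ₗ.[ℝ] L2 Ω Symm := (symCurlGraph Ω).toLinearPMap

/-- `div div` as an unbounded operator, with domain
`H(div div; 𝕊) = {M ∈ L²(Ω, 𝕊) : div div M ∈ L²(Ω)}`. -/
def divDiv : L2 Ω Symm →ₗ.[ℝ] L2 Ω ℝ := (divDivGraph Ω).toLinearPMap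

/-! ### The space `X` and the Hodge-Dirac operator -/

/-- The Hilbert space `X = L²(Ω, 𝕍) ⊕ L²(Ω, 𝕋) ⊕ L²(Ω, 𝕊) ⊕ L²(Ω, ℝ)`. -/
def X : Type :=
  WithLp 2 (L2 Ω Vec × WithLp 2 (L2 Ω TraceFree × WithLp 2 (L2 Ω Symm × L2 Ω ℝ)))

instance : NormedAddCommGroup (X Ω) := inferInstanceAs (NormedAddCommGroup
  (WithLp 2 (L2 Ω Vec × WithLp 2 (L2 Ω TraceFree × WithLp 2 (L2 Ω Symm × L2 Ω ℝ)))))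

instance : InnerProductSpace ℝ (X Ω) := inferInstanceAs (InnerProductSpace ℝ
  (WithLp 2 (L2 Ω Vec × WithLp 2 (L2 Ω TraceFree × WithLp 2 (L2 Ω Symm × L2 Ω ℝ)))))

instance : CompleteSpace (X Ω) := inferInstanceAs (CompleteSpace
  (WithLp 2 (L2 Ω Vec × WithLp 2 (L2 Ω TraceFree × WithLp 2 (L2 Ω Symm × L2 Ω ℝ)))))

section Components

variable {Ω}

/-- The element of `X` with the given four components. -/
def X.mk (l₀ : L2 Ω Vec) (A : L2 Ω TraceFree) (g : L2 Ω Symm) (l₃ : L2 Ω ℝ) : X Ω :=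
  WithLp.toLp 2 (l₀, WithLp.toLp 2 (A, WithLp.toLp 2 (g, l₃)))

lemma X.mk_add (l₀ m₀ : L2 Ω Vec) (A B : L2 Ω TraceFree) (g h : L2 Ω Symm) (l₃ m₃ : L2 Ω ℝ) :
    X.mk (l₀ + m₀) (A + B) (g + h) (l₃ + m₃) = X.mk l₀ A g l₃ + X.mk m₀ B h m₃ := rfl

lemma X.mk_smul (c : ℝ) (l₀ : L2 Ω Vec) (A : L2 Ω TraceFree) (g : L2 Ω Symm) (l₃ : L2 Ω ℝ) :
    X.mk (c • l₀) (c • A) (c • g) (c • l₃) = c • X.mk l₀ A g l₃ := rfl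

/-- The component of `U ∈ X` in `L²(Ω, 𝕍)`. -/
def X.c₀ : X Ω →ₗ[ℝ] L2 Ω Vec where
  toFun U := WithLp.fst U
  map_add' _ _ := rfl
  map_smul' _ _ := rfl

/-- The component of `U ∈ X` in `L²(Ω, 𝕋)`. -/
def X.c₁ : X Ω →ₗ[ℝ] L2 Ω TraceFree where
  toFun U := (WithLp.snd U).fst
  map_add' _ _ := rfl
  map_smul' _ _ := rfl

/-- The component of `U ∈ X` in `L²(Ω, 𝕊)`. -/
def X.c₂ : X Ω →ₗ[ℝ] L2 Ω Symm where
  toFun U := (WithLp.snd U).snd.fst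
  map_add' _ _ := rfl
  map_smul' _ _ := rfl

/-- The component of `U ∈ X` in `L²(Ω, ℝ)`. -/
def X.c₃ : X Ω →ₗ[ℝ] L2 Ω ℝ where
  toFun U := (WithLp.snd U).snd.snd
  map_add' _ _ := rfl
  map_smul' _ _ := rfl

end Components

lemma pmap_add {E F : Type} [AddCommGroup E] [Module ℝ E] [AddCommGroup F] [Module ℝ F]
    (f : E →ₗ.[ℝ] F) {x y z : E} (hx : x ∈ f.domain) (hy : y ∈ f.domain) (hz : z ∈ f.domain)
    (h : z = x + y) : f ⟨z, hz⟩ = f ⟨x, hx⟩ + f ⟨y, hy⟩ := by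
  subst h
  exact f.map_add ⟨x, hx⟩ ⟨y, hy⟩

lemma pmap_smul {E F : Type} [AddCommGroup E] [Module ℝ E] [AddCommGroup F] [Module ℝ F]
    (f : E →ₗ.[ℝ] F) (c : ℝ) {x z : E} (hx : x ∈ f.domain) (hz : z ∈ f.domain)
    (h : z = c • x) : f ⟨z, hz⟩ = c • f ⟨x, hx⟩ := by
  subst h
  exact f.map_smul c ⟨x, hx⟩

/-- `D(d) = H(dev grad; 𝕍) ⊕ H(sym curl; 𝕋) ⊕ H(div div; 𝕊) ⊕ L²(Ω)`. -/
def dDomain : Submodule ℝ (X Ω) :=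
  (devGrad Ω).domain.comap X.c₀ ⊓ (symCurl Ω).domain.comap X.c₁ ⊓ (divDiv Ω).domain.comap X.c₂

section

variable {Ω}

lemma mem₀ (U : dDomain Ω) : X.c₀ U.1 ∈ (devGrad Ω).domain := U.2.1.1
lemma mem₁ (U : dDomain Ω) : X.c₁ U.1 ∈ (symCurl Ω).domain := U.2.1.2
lemma mem₂ (U : dDomain Ω) : X.c₂ U.1 ∈ (divDiv Ω).domain := U.2.2

end

/-- The operator `d (u₀, u₁, u₂, u₃) = (0, dev grad u₀, sym curl u₁, div div u₂)`. -/
def d : X Ω →ₗ.[ℝ] X Ω where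
  domain := dDomain Ω
  toFun :=
    { toFun := fun U => X.mk 0 (devGrad Ω ⟨X.c₀ U.1, mem₀ U⟩) (symCurl Ω ⟨X.c₁ U.1, mem₁ U⟩)
        (divDiv Ω ⟨X.c₂ U.1, mem₂ U⟩)
      map_add' := fun U V => by
        rw [pmap_add (devGrad Ω) (mem₀ U) (mem₀ V) (mem₀ (U + V)) (map_add X.c₀ U.1 V.1),
          pmap_add (symCurl Ω) (mem₁ U) (mem₁ V) (mem₁ (U + V)) (map_add X.c₁ U.1 V.1),
          pmap_add (divDiv Ω) (mem₂ U) (mem₂ V) (mem₂ (U + V)) (map_add X.c₂ U.1 V.1),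
          ← X.mk_add, add_zero]
      map_smul' := fun c U => by
        rw [pmap_smul (devGrad Ω) c (mem₀ U) (mem₀ (c • U)) (map_smul X.c₀ c U.1),
          pmap_smul (symCurl Ω) c (mem₁ U) (mem₁ (c • U)) (map_smul X.c₁ c U.1),
          pmap_smul (divDiv Ω) c (mem₂ U) (mem₂ (c • U)) (map_smul X.c₂ c U.1),
          RingHom.id_apply, ← X.mk_smul, smul_zero] }

/-- `J = diag(1, -1, 1, -1)`. -/
def J : X Ω →ₗ[ℝ] X Ω where
  toFun U := X.mk (X.c₀ U) (-X.c₁ U) (X.c₂ U) (-X.c₃ U)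
  map_add' U V := by
    rw [← X.mk_add]; simp only [map_add, neg_add]
  map_smul' c U := by
    rw [RingHom.id_apply, ← X.mk_smul]; simp only [map_smul, smul_neg]

/-- The Hilbert space adjoint of `dev grad` (it acts as `-div`). -/
def devGradAdj : L2 Ω TraceFree →ₗ.[ℝ] L2 Ω Vec := LinearPMap.adjoint (𝕜 := ℝ) (devGrad Ω)

/-- The Hilbert space adjoint of `sym curl` (it acts as `curl`). -/
def symCurlAdj : L2 Ω Symm →ₗ.[ℝ] L2 Ω TraceFree := LinearPMap.adjoint (𝕜 := ℝ) (symCurl Ω)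

/-- The operator `𝓛 = J (d + d*)`, where `d*` is the Hilbert space adjoint of the unbounded
operator `d`; its domain is `D(𝓛) = D(d) ∩ D(d*)`. -/
def L : X Ω →ₗ.[ℝ] X Ω := (J Ω).compPMap (d Ω + (d Ω)†)

lemma L_domain : (L Ω).domain = (d Ω).domain ⊓ (d Ω)†.domain := rfl

/-- `S` acting pointwise on square-integrable symmetric matrix fields. -/
def S : L2 Ω Symm →L[ℝ] L2 Ω Symm :=
  symmS.compLpL 2 (volume.restrict (Ω : Set Vec))

/-! ### Solutions on a time interval -/

variable {T : ℝ}

/-- `U ∈ C⁰([0, T], D(𝓛)) ∩ C¹([0, T], X)` solves `∂ₜ U = 𝓛 U`, `U(0) = U₀`.  Continuity into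
`D(𝓛)` is for the graph norm, i.e. `U` and `𝓛 U` are continuous into `X`. -/
structure IsDiracSolution (hT : 0 < T) (U₀ : X Ω) (U : C(Icc 0 T, X Ω)) : Prop where
  mem_domain : ∀ t, U t ∈ (L Ω).domain
  continuous_L : Continuous fun t => L Ω ⟨U t, mem_domain t⟩
  hasDerivWithinAt : ∀ t : Icc 0 T,
    HasDerivWithinAt (IccExtend hT.le U) (L Ω ⟨U t, mem_domain t⟩) (Icc 0 T) t
  initial : U ⟨0, left_mem_Icc.2 hT.le⟩ = U₀

/-- `(A, γ)` solves the reformulated ADM system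
`div A = 0`, `Aₜ + curl S γ = 0`, `S γₜ - sym curl A = 0`, `div div S γ = 0` on `[0, T]`, with
`A(0) = A₀` and `γ(0) = γ₀`.  Here `-div` and `curl` are the Hilbert space adjoints of the unbounded
operators `dev grad` and `sym curl`; all terms are continuous in time with values in `L²`. -/
structure IsADMSolution (hT : 0 < T) (A₀ : L2 Ω TraceFree) (γ₀ : L2 Ω Symm)
    (A : C(Icc 0 T, L2 Ω TraceFree)) (γ : C(Icc 0 T, L2 Ω Symm)) : Prop where
  A_mem : ∀ t, A t ∈ (symCurl Ω).domain
  A_mem_adjoint : ∀ t, A t ∈ (devGradAdj Ω).domain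
  γ_mem : ∀ t, S Ω (γ t) ∈ (divDiv Ω).domain
  γ_mem_adjoint : ∀ t, S Ω (γ t) ∈ (symCurlAdj Ω).domain
  continuous_symCurl : Continuous fun t => symCurl Ω ⟨A t, A_mem t⟩
  continuous_curl : Continuous fun t => symCurlAdj Ω ⟨S Ω (γ t), γ_mem_adjoint t⟩
  div_A : ∀ t, -devGradAdj Ω ⟨A t, A_mem_adjoint t⟩ = 0
  deriv_A : ∀ t : Icc 0 T, HasDerivWithinAt (IccExtend hT.le A)
    (-symCurlAdj Ω ⟨S Ω (γ t), γ_mem_adjoint t⟩) (Icc 0 T) t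
  deriv_γ : ∀ t : Icc 0 T, HasDerivWithinAt (IccExtend hT.le fun s => S Ω (γ s))
    (symCurl Ω ⟨A t, A_mem t⟩) (Icc 0 T) t
  divdiv_γ : ∀ t, divDiv Ω ⟨S Ω (γ t), γ_mem t⟩ = 0
  initial_A : A ⟨0, left_mem_Icc.2 hT.le⟩ = A₀
  initial_γ : γ ⟨0, left_mem_Icc.2 hT.le⟩ = γ₀

end DivDiv

end

/-! Since `J` alternates in sign and `d` raises the degree by one, `J d = -d J`. Hence `δ = J d` is
closed with `δ² = 0`, its adjoint is `-J d*`, and `𝓛 = δ - δ*`. This operator is skew, so the norm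
of a solution is constant; that gives both the bound and uniqueness.

Existence is the Hille-Yosida argument. The missing ingredient is that `1 - h 𝓛` is onto for every
`h > 0`. `exists_add_smul_sub_adjoint_eq` obtains it from two orthogonal projections, onto `ker δ`
and onto the graph of a multiple of `δ`. The bounded Yosida approximations `𝓛 (1 - h 𝓛)⁻¹` are
dissipative and commute, and their exponentials converge uniformly on `[0, T]` (`cauchySeq_orbit`,
`exists_solution`). A closed subspace invariant under the resolvents is invariant under these
exponentials, hence under the limit.

For the second part, the constraints cut out a closed subspace. The resolvents preserve it because
the complex property decouples the two outer components: each satisfies `u = -h² T*T u` or `c = -h²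
T T* c`, and so vanishes. On this subspace `∂ₜU = 𝓛U` is the ADM system, and ADM solutions padded
with zeros solve the Dirac equation, so uniqueness carries over. The initial condition on the
distributional divergence is converted into one on `(dev grad)*` by testing with smooth compactly
supported fields. -/

set_option autoImplicit false

/-! ### Resolvents and Yosida approximations of a skew operator. -/

namespace SkewGenerator

open Filter Topology
open scoped InnerProductSpace

variable {H : Type*} [NormedAddCommGroup H] [InnerProductSpace ℝ H]

/-- A linear relation `G` on a Hilbert space which is the graph of a densely defined skew operator
`A` such that `1 - h A` is onto for all `h > 0`. -/
structure IsSkewGenerator (G : Submodule ℝ (H × H)) : Prop where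
  dense : Dense {x : H | ∃ y, (x, y) ∈ G}
  skew : ∀ p ∈ G, ⟪p.2, p.1⟫_ℝ = 0
  surj : ∀ h : ℝ, 0 < h → ∀ f : H, ∃ p ∈ G, p.1 - h • p.2 = f

namespace IsSkewGenerator

variable {G : Submodule ℝ (H × H)}

/-- Pythagoras: skewness makes the two entries of `p` orthogonal. This yields injectivity of `1 - h
A` and contractivity of its inverse. -/
lemma norm_fst_le (hG : IsSkewGenerator G) (h : ℝ) {p : H × H} (hp : p ∈ G) :
    ‖p.1‖ ≤ ‖p.1 - h • p.2‖ := by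
  have h1 : ‖p.1 - h • p.2‖ ^ 2 = ‖p.1‖ ^ 2 + ‖h • p.2‖ ^ 2 := by
    rw [norm_sub_sq_real, inner_smul_right, real_inner_comm, hG.skew p hp]
    ring
  exact (sq_le_sq₀ (norm_nonneg _) (norm_nonneg _)).1 (by nlinarith [sq_nonneg ‖h • p.2‖])

lemma eq_of_sub_smul_eq (hG : IsSkewGenerator G) {h : ℝ} (hh : 0 < h) {p q : H × H} (hp : p ∈ G)
    (hq : q ∈ G) (hpq : p.1 - h • p.2 = q.1 - h • q.2) : p = q := by
  have h1 := hG.norm_fst_le h (G.sub_mem hp hq)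
  have h2 : (p - q).1 - h • (p - q).2 = 0 := by
    rw [Prod.fst_sub, Prod.snd_sub, smul_sub, ← sub_eq_zero.2 hpq]; abel
  rw [h2, norm_zero, norm_le_zero_iff] at h1
  rw [h1, zero_sub, neg_eq_zero, smul_eq_zero] at h2
  exact sub_eq_zero.1 (Prod.ext h1 (h2.resolve_left hh.ne'))

/-- The resolvent `(1 - h A)⁻¹`. -/
noncomputable def resolvent (hG : IsSkewGenerator G) {h : ℝ} (hh : 0 < h) : H →L[ℝ] H :=
  LinearMap.mkContinuous
    { toFun := fun f => (hG.surj h hh f).choose.1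
      map_add' := fun f g => by
        have hf := (hG.surj h hh f).choose_spec
        have hg := (hG.surj h hh g).choose_spec
        have hfg := (hG.surj h hh (f + g)).choose_spec
        have := hG.eq_of_sub_smul_eq hh hfg.1 (G.add_mem hf.1 hg.1) (by
          rw [hfg.2, Prod.fst_add, Prod.snd_add, smul_add, add_sub_add_comm, hf.2, hg.2])
        rw [this, Prod.fst_add]
      map_smul' := fun c f => by
        have hf := (hG.surj h hh f).choose_spec
        have hcf := (hG.surj h hh (c • f)).choose_spec
        have := hG.eq_of_sub_smul_eq hh hcf.1 (G.smul_mem c hf.1) (by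
          rw [hcf.2, Prod.smul_fst, Prod.smul_snd, smul_comm, ← smul_sub, hf.2])
        rw [this, Prod.smul_fst, RingHom.id_apply] }
    1 (fun f => by
      have hf := (hG.surj h hh f).choose_spec
      rw [one_mul]
      exact (hG.norm_fst_le h hf.1).trans_eq (by rw [hf.2]))

/-- The Yosida approximation `A (1 - h A)⁻¹`. -/
noncomputable def yosida (hG : IsSkewGenerator G) {h : ℝ} (hh : 0 < h) : H →L[ℝ] H :=
  h⁻¹ • (hG.resolvent hh - 1)

variable (hG : IsSkewGenerator G) {h k : ℝ} (hh : 0 < h) (hk : 0 < k)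

include hG in
lemma norm_resolvent_apply_le (f : H) : ‖hG.resolvent hh f‖ ≤ ‖f‖ := by
  have hf := (hG.surj h hh f).choose_spec
  exact (hG.norm_fst_le h hf.1).trans_eq (by rw [hf.2])

lemma yosida_apply (f : H) : hG.yosida hh f = h⁻¹ • (hG.resolvent hh f - f) := rfl

lemma resolvent_yosida_mem (f : H) : (hG.resolvent hh f, hG.yosida hh f) ∈ G := by
  have hf := (hG.surj h hh f).choose_spec
  convert hf.1 using 1
  refine Prod.ext rfl ?_
  change h⁻¹ • ((hG.surj h hh f).choose.1 - f) = _
  conv_lhs => enter [2, 2]; rw [← hf.2]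
  rw [sub_sub_cancel, inv_smul_smul₀ hh.ne']

lemma resolvent_sub_smul {p : H × H} (hp : p ∈ G) : hG.resolvent hh (p.1 - h • p.2) = p.1 := by
  have hf := (hG.surj h hh (p.1 - h • p.2)).choose_spec
  exact congrArg Prod.fst (hG.eq_of_sub_smul_eq hh hf.1 hp hf.2)

lemma resolvent_sub_smul_yosida (f : H) : hG.resolvent hh f - h • hG.yosida hh f = f := by
  rw [yosida_apply, smul_inv_smul₀ hh.ne', sub_sub_cancel]

/-- The operator commutes with its resolvent on its domain, which makes the Yosida approximations
converge there. -/
lemma yosida_apply_fst {p : H × H} (hp : p ∈ G) : hG.yosida hh p.1 = hG.resolvent hh p.2 := by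
  have h1 := hG.resolvent_sub_smul hh hp
  rw [map_sub, map_smul, sub_eq_iff_eq_add] at h1
  rw [yosida_apply, h1, add_sub_cancel_left, inv_smul_smul₀ hh.ne']

/-- Writing `f = R f - h A R f` and using `A R f ⊥ R f`, the left side equals `-h ‖A R f‖²`. -/
lemma inner_yosida_le (f : H) : ⟪hG.yosida hh f, f⟫_ℝ ≤ 0 := by
  have h1 : ⟪hG.yosida hh f, f⟫_ℝ =
      ⟪hG.yosida hh f, hG.resolvent hh f - h • hG.yosida hh f⟫_ℝ := by
    rw [hG.resolvent_sub_smul_yosida hh f]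
  rw [h1, inner_sub_right, hG.skew _ (hG.resolvent_yosida_mem hh f), inner_smul_right,
    real_inner_self_eq_norm_sq, zero_sub, neg_nonpos]
  positivity

lemma resolvent_comm (f : H) :
    hG.resolvent hh (hG.resolvent hk f) = hG.resolvent hk (hG.resolvent hh f) := by
  by_cases hne : h = k
  · subst hne; rfl
  -- Both identities compare `h⁻¹` and `k⁻¹` multiples of the two products. In their sum the terms
  -- with a single resolvent cancel, leaving `h⁻¹ - k⁻¹` times the commutator.
  have h1 := hG.yosida_apply_fst hh (hG.resolvent_yosida_mem hk f)
  have h2 := hG.yosida_apply_fst hk (hG.resolvent_yosida_mem hh f)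
  simp only [yosida_apply, map_smul, map_sub] at h1 h2
  have h3 : (h⁻¹ - k⁻¹) • (hG.resolvent hh (hG.resolvent hk f) -
      hG.resolvent hk (hG.resolvent hh f)) = 0 := by
    have := congrArg₂ (· + ·) h1 h2
    simp only [smul_sub, sub_smul] at this ⊢
    rw [← sub_eq_zero] at this
    rw [← this]; abel
  rw [smul_eq_zero, sub_eq_zero, inv_inj, sub_eq_zero] at h3
  exact h3.resolve_left hne

lemma commute_yosida : Commute (hG.yosida hh) (hG.yosida hk) := by
  have h1 : Commute (hG.resolvent hh) (hG.resolvent hk) :=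
    ContinuousLinearMap.ext fun f => hG.resolvent_comm hh hk f
  exact (((h1.sub_left (Commute.one_left _)).sub_right (Commute.one_right _)).smul_left _).smul_right _

lemma commute_resolvent_yosida : Commute (hG.resolvent hh) (hG.yosida hh) :=
  ((Commute.refl _).sub_right (Commute.one_right _)).smul_right _

lemma norm_resolvent_sub_le {p : H × H} (hp : p ∈ G) :
    ‖hG.resolvent hh p.1 - p.1‖ ≤ h * ‖p.2‖ := by
  have h1 := hG.resolvent_sub_smul hh hp
  rw [map_sub, map_smul, sub_eq_iff_eq_add] at h1
  rw [h1, add_sub_cancel_left, norm_smul, Real.norm_of_nonneg hh.le]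
  exact mul_le_mul_of_nonneg_left (hG.norm_resolvent_apply_le hh _) hh.le

include hG in
/-- The graph is closed. -/
lemma isClosed : IsClosed (G : Set (H × H)) := by
  -- Membership in the graph is an equation between continuous maps: `(x, y) ∈ G` exactly when the
  -- resolvent at step 1 sends `x - y` to `x`.
  have h1 : (G : Set (H × H)) = {p | hG.resolvent one_pos (p.1 - p.2) = p.1} := by
    ext p
    constructor
    · intro hp
      simpa using hG.resolvent_sub_smul one_pos hp
    · intro hp
      have h2 := hG.resolvent_yosida_mem one_pos (p.1 - p.2)
      have hp' : hG.resolvent one_pos (p.1 - p.2) = p.1 := hp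
      rw [yosida_apply, hp', inv_one, one_smul, sub_sub_cancel] at h2
      exact h2
  rw [h1]
  exact isClosed_eq (by fun_prop) continuous_fst

/-- The resolvents converge strongly to the identity. -/
lemma tendsto_resolvent {h : ℕ → ℝ} (hh : ∀ n, 0 < h n) (hlim : Tendsto h atTop (𝓝 0)) (x : H) :
    Tendsto (fun n => hG.resolvent (hh n) x) atTop (𝓝 x) := by
  rw [Metric.tendsto_atTop]
  intro ε hε
  obtain ⟨z, ⟨y, hy⟩, hz⟩ := hG.dense.exists_dist_lt x (by positivity : 0 < ε / 3)
  have h1 : Tendsto (fun n => h n * ‖y‖) atTop (𝓝 0) := by simpa using hlim.mul_const ‖y‖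
  obtain ⟨N, hN⟩ := (h1.eventually_lt_const (by positivity : 0 < ε / 3)).exists_forall_of_atTop
  refine ⟨N, fun n hn => ?_⟩
  have h2 := hG.norm_resolvent_sub_le (hh n) hy
  have h3 := hG.norm_resolvent_apply_le (hh n) (x - z)
  rw [dist_eq_norm] at hz ⊢
  have h4 : hG.resolvent (hh n) x - x = hG.resolvent (hh n) (x - z) +
    (hG.resolvent (hh n) z - z) - (x - z) := by rw [map_sub]; abel
  rw [h4]
  have h5 := norm_sub_le (hG.resolvent (hh n) (x - z) + (hG.resolvent (hh n) z - z)) (x - z)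
  have h6 := norm_add_le (hG.resolvent (hh n) (x - z)) (hG.resolvent (hh n) z - z)
  have := hN n hn
  simp only at h2
  linarith

end IsSkewGenerator

end SkewGenerator

/-! ### Exponentials of the approximations and their limit. -/

namespace SkewGenerator

open Filter Topology
open scoped InnerProductSpace

variable {H : Type*} [NormedAddCommGroup H] [InnerProductSpace ℝ H] [CompleteSpace H]

section Exp

open NormedSpace

lemma hasDerivAt_exp_apply (A : H →L[ℝ] H) (x : H) (t : ℝ) :
    HasDerivAt (fun s : ℝ => exp (s • A) x) (A (exp (t • A) x)) t := by
  have h := hasDerivAt_exp_smul_const' (𝕂 := ℝ) A t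
  exact h.clm_apply (hasDerivAt_const t x) |>.congr_deriv (by simp)

omit [CompleteSpace H] in
lemma exp_apply_comm {A B : H →L[ℝ] H} (h : Commute A B) (t : ℝ) (x : H) :
    B (exp (t • A) x) = exp (t • A) (B x) :=
  (DFunLike.congr_fun ((h.smul_left t).exp_left).eq x).symm

lemma norm_exp_apply_le {A : H →L[ℝ] H} (hA : ∀ x, ⟪A x, x⟫_ℝ ≤ 0) {t : ℝ} (ht : 0 ≤ t) (x : H) :
    ‖exp (t • A) x‖ ≤ ‖x‖ := by
  have h1 : Antitone fun s : ℝ => ‖exp (s • A) x‖ ^ 2 :=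
    antitone_of_hasDerivAt_nonpos (fun s => (hasDerivAt_exp_apply A x s).norm_sq) fun s => by
      have := hA (exp (s • A) x)
      rw [real_inner_comm] at this
      simp only [Pi.zero_apply]
      linarith
  have h2 := h1 ht
  simp only [zero_smul, exp_zero, one_apply_eq_self] at h2
  exact (sq_le_sq₀ (norm_nonneg _) (norm_nonneg _)).1 h2

/-- Duhamel interpolation: `exp((t-s)B) exp(sA) x` joins the two exponentials. By commutativity its
derivative is a product of contractions applied to `A x - B x`. -/
lemma norm_exp_sub_exp_apply_le {A B : H →L[ℝ] H} (hA : ∀ x, ⟪A x, x⟫_ℝ ≤ 0)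
    (hB : ∀ x, ⟪B x, x⟫_ℝ ≤ 0) (hAB : Commute A B) {t : ℝ} (ht : 0 ≤ t) (x : H) :
    ‖exp (t • A) x - exp (t • B) x‖ ≤ ‖A x - B x‖ * t := by
  set w : ℝ → H := fun s => exp ((t - s) • B) (exp (s • A) x)
  have hw : ∀ s : ℝ, HasDerivAt w (exp ((t - s) • B) (exp (s • A) (A x - B x))) s := by
    intro s
    have h1 := (hasDerivAt_exp_smul_const (𝕂 := ℝ) B (t - s)).scomp s
      ((hasDerivAt_id s).const_sub t)
    refine (h1.clm_apply (hasDerivAt_exp_apply A x s)).congr_deriv ?_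
    rw [map_sub, map_sub, exp_apply_comm (Commute.refl A), ← exp_apply_comm hAB]
    simp only [neg_smul, one_smul, neg_apply, mul_apply_eq_comp]
    abel
  have h2 := norm_image_sub_le_of_norm_deriv_le_segment' (a := 0) (b := t) (C := ‖A x - B x‖)
    (fun s _ => (hw s).hasDerivWithinAt)
    (fun s hs => (norm_exp_apply_le hB (by linarith [hs.2]) _).trans
      (norm_exp_apply_le hA hs.1 _)) t (right_mem_Icc.2 ht)
  simpa [w] using h2

/-- The partial sums of the exponential series stay in `Y`, and `Y` is closed. -/
lemma exp_apply_mem {A : H →L[ℝ] H} {Y : Submodule ℝ H} (hY : IsClosed (Y : Set H))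
    (hA : ∀ x ∈ Y, A x ∈ Y) (t : ℝ) {x : H} (hx : x ∈ Y) : exp (t • A) x ∈ Y := by
  have h1 : HasSum (fun n : ℕ => ((n.factorial : ℝ)⁻¹ • (t • A) ^ n) x) (exp (t • A) x) :=
    (exp_series_hasSum_exp' (𝕂 := ℝ) (t • A)).mapL (ContinuousLinearMap.apply ℝ H x)
  have h2 : ∀ n : ℕ, ((t • A) ^ n) x ∈ Y := by
    intro n
    induction n with
    | zero => simpa using hx
    | succ n ih => rw [pow_succ']; exact Y.smul_mem t (hA _ ih)
  refine hY.mem_of_tendsto h1 (Eventually.of_forall fun s => Y.sum_mem fun n _ => ?_)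
  exact Y.smul_mem _ (h2 n)

/-- The orbit map `x ↦ (t ↦ exp(tA) x)` on `[0, T]` for a dissipative bounded operator `A`. -/
noncomputable def orbit (T : ℝ) {A : H →L[ℝ] H} (hA : ∀ x, ⟪A x, x⟫_ℝ ≤ 0) :
    H →L[ℝ] C(Icc 0 T, H) :=
  LinearMap.mkContinuous
    { toFun := fun x => ⟨fun t => exp ((t : ℝ) • A) x, by
        have : Continuous fun s : ℝ => exp (s • A) x :=
          continuous_iff_continuousAt.2 fun s => (hasDerivAt_exp_apply A x s).continuousAt
        exact this.comp continuous_subtype_val⟩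
      map_add' := fun x y => by ext t; simp
      map_smul' := fun c x => by ext t; simp }
    1 fun x => by
      rw [one_mul]
      exact (ContinuousMap.norm_le _ (norm_nonneg _)).2 fun t => norm_exp_apply_le hA t.2.1 x

lemma orbit_apply (T : ℝ) {A : H →L[ℝ] H} (hA : ∀ x, ⟪A x, x⟫_ℝ ≤ 0) (x : H) (t : Icc 0 T) :
    orbit T hA x t = exp ((t : ℝ) • A) x := rfl

lemma norm_orbit_le (T : ℝ) {A : H →L[ℝ] H} (hA : ∀ x, ⟪A x, x⟫_ℝ ≤ 0) (x : H) :
    ‖orbit T hA x‖ ≤ ‖x‖ :=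
  (ContinuousMap.norm_le _ (norm_nonneg _)).2 fun t => norm_exp_apply_le hA t.2.1 x

/-- The integrated form of the equation passes to uniform limits, unlike the differential one. -/
lemma orbit_eq_add_integral {T : ℝ} (hT : 0 < T) {A : H →L[ℝ] H} (hA : ∀ x, ⟪A x, x⟫_ℝ ≤ 0)
    (x : H) (t : Icc 0 T) :
    orbit T hA x t = x + ∫ s in (0 : ℝ)..t, IccExtend hT.le (orbit T hA (A x)) s := by
  have hc : Continuous (IccExtend hT.le (orbit T hA (A x))) := (orbit T hA (A x)).continuous.Icc_extend'
  have h1 := intervalIntegral.integral_eq_sub_of_hasDerivAt (a := 0) (b := t)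
    (f := fun s : ℝ => exp (s • A) x) (f' := IccExtend hT.le (orbit T hA (A x)))
    (fun s hs => by
      rw [uIcc_of_le t.2.1] at hs
      rw [IccExtend_of_mem _ _ ⟨hs.1, hs.2.trans t.2.2⟩, orbit_apply,
        ← exp_apply_comm (Commute.refl A)]
      exact hasDerivAt_exp_apply A x s) (hc.intervalIntegrable _ _)
  rw [h1, orbit_apply]
  simp

end Exp

omit [CompleteSpace H] in
lemma continuous_integral_IccExtend {T : ℝ} (hT : 0 < T) (t : ℝ) :
    Continuous fun w : C(Icc 0 T, H) => ∫ s in (0 : ℝ)..t, IccExtend hT.le w s := by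
  refine intervalIntegral.continuous_parametric_intervalIntegral_of_continuous'
    (f := fun (w : C(Icc 0 T, H)) s => IccExtend hT.le w s) ?_ 0 t
  exact continuous_fst.eval (continuous_projIcc.comp continuous_snd)

lemma hasDerivWithinAt_of_eq_add_integral {T : ℝ} (hT : 0 < T) {x : H} {u v : C(Icc 0 T, H)}
    (h : ∀ t : Icc 0 T, u t = x + ∫ s in (0 : ℝ)..t, IccExtend hT.le v s) (t : Icc 0 T) :
    HasDerivWithinAt (IccExtend hT.le u) (v t) (Icc 0 T) t := by
  have hc : Continuous (IccExtend hT.le v) := v.continuous.Icc_extend'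
  have h1 : HasDerivAt (fun r : ℝ => x + ∫ s in (0 : ℝ)..r, IccExtend hT.le v s) (v t) t := by
    have := (intervalIntegral.integral_hasDerivAt_right (hc.intervalIntegrable 0 t)
      (hc.stronglyMeasurableAtFilter _ _) hc.continuousAt).const_add x
    rwa [IccExtend_val] at this
  refine h1.hasDerivWithinAt.congr (fun r hr => ?_) ?_
  · rw [IccExtend_of_mem _ _ hr, h]
  · rw [IccExtend_val, h]

namespace IsSkewGenerator

variable {G : Submodule ℝ (H × H)} (hG : IsSkewGenerator G)

lemma cauchySeq_orbit {T : ℝ} {h : ℕ → ℝ} (hh : ∀ n, 0 < h n) (hlim : Tendsto h atTop (𝓝 0))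
    (x : H) : CauchySeq fun n => orbit T (hG.inner_yosida_le (hh n)) x := by
  rcases lt_or_ge T 0 with hT | hT
  · have : IsEmpty (Icc 0 T) := isEmpty_coe_sort.2 (Icc_eq_empty (not_le.2 hT))
    have : Subsingleton C(Icc 0 T, H) := ⟨fun a b => ContinuousMap.ext fun t => isEmptyElim t⟩
    exact (tendsto_const_nhds (x := (0 : C(Icc 0 T, H)))).congr
      (fun n => Subsingleton.elim _ _) |>.cauchySeq
  -- On the domain, orbits differ by at most `T` times the difference of the Yosida approximations
  -- at `p.1`, and these converge. Density and the uniform contraction bound extend this to every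
  -- `x`.
  have key : ∀ p ∈ G, CauchySeq fun n => orbit T (hG.inner_yosida_le (hh n)) p.1 := by
    intro p hp
    have h1 : CauchySeq fun n => T • hG.yosida (hh n) p.1 := by
      refine Tendsto.cauchySeq (x := T • p.2) (Tendsto.const_smul ?_ T)
      simpa only [hG.yosida_apply_fst (hh _) hp] using hG.tendsto_resolvent hh hlim p.2
    refine Metric.cauchySeq_iff'.2 fun ε hε => ?_
    obtain ⟨n, hn⟩ := Metric.cauchySeq_iff'.1 h1 ε hε
    refine ⟨n, fun m hm => lt_of_le_of_lt ?_ (hn m hm)⟩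
    rw [dist_eq_norm, dist_eq_norm, ← smul_sub, norm_smul, Real.norm_of_nonneg hT]
    refine (ContinuousMap.norm_le _ (by positivity)).2 fun t => ?_
    rw [ContinuousMap.sub_apply, orbit_apply, orbit_apply, mul_comm]
    exact (norm_exp_sub_exp_apply_le (hG.inner_yosida_le (hh m)) (hG.inner_yosida_le (hh n))
      (hG.commute_yosida (hh m) (hh n)) t.2.1 p.1).trans
      (mul_le_mul_of_nonneg_left t.2.2 (norm_nonneg _))
  rw [Metric.cauchySeq_iff']
  intro ε hε
  obtain ⟨z, ⟨y, hy⟩, hz⟩ := hG.dense.exists_dist_lt x (by positivity : 0 < ε / 3)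
  obtain ⟨N, hN⟩ := Metric.cauchySeq_iff'.1 (key _ hy) (ε / 3) (by positivity)
  refine ⟨N, fun n hn => ?_⟩
  have hb : ∀ m, dist (orbit T (hG.inner_yosida_le (hh m)) x)
      (orbit T (hG.inner_yosida_le (hh m)) z) < ε / 3 := fun m => by
    rw [dist_eq_norm, ← map_sub]
    exact (norm_orbit_le T _ _).trans_lt (by rwa [← dist_eq_norm])
  have h2 := dist_triangle4 (orbit T (hG.inner_yosida_le (hh n)) x)
    (orbit T (hG.inner_yosida_le (hh n)) z) (orbit T (hG.inner_yosida_le (hh N)) z)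
    (orbit T (hG.inner_yosida_le (hh N)) x)
  have h3 := hb N
  rw [dist_comm] at h3
  linarith [hb n, hN n hn]

include hG in
/-- Solutions of `u' = A u` for initial values in the domain of `A`; they stay in every closed
subspace that is invariant under the resolvents of `A`. -/
theorem exists_solution {T : ℝ} (hT : 0 < T) {x y : H} (hxy : (x, y) ∈ G) :
    ∃ u v : C(Icc 0 T, H), (∀ t, (u t, v t) ∈ G) ∧
      (∀ t : Icc 0 T, HasDerivWithinAt (IccExtend hT.le u) (v t) (Icc 0 T) t) ∧
      u ⟨0, left_mem_Icc.2 hT.le⟩ = x ∧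
      ∀ Y : Submodule ℝ H, IsClosed (Y : Set H) →
        (∀ h : ℝ, 0 < h → ∀ p ∈ G, p.1 - h • p.2 ∈ Y → p.1 ∈ Y) → x ∈ Y → ∀ t, u t ∈ Y := by
  set h : ℕ → ℝ := fun n => 1 / ((n : ℝ) + 1)
  have hh : ∀ n, 0 < h n := fun n => Nat.one_div_pos_of_nat
  have hlim : Tendsto h atTop (𝓝 0) := tendsto_one_div_add_atTop_nhds_zero_nat
  set E : ℕ → H →L[ℝ] C(Icc 0 T, H) := fun n => orbit T (hG.inner_yosida_le (hh n))
  obtain ⟨u, hu⟩ := cauchySeq_tendsto_of_complete (hG.cauchySeq_orbit (T := T) hh hlim x)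
  obtain ⟨v, hv⟩ := cauchySeq_tendsto_of_complete (hG.cauchySeq_orbit (T := T) hh hlim y)
  -- The orbit maps are uniformly bounded, so inserting a resolvent does not change the limit.
  have hlimR : ∀ z, Tendsto (fun n => E n (hG.resolvent (hh n) z) - E n z) atTop (𝓝 0) := by
    intro z
    have h1 := tendsto_iff_norm_sub_tendsto_zero.1 (hG.tendsto_resolvent hh hlim z)
    refine squeeze_zero_norm (fun n => ?_) h1
    rw [← map_sub]
    exact norm_orbit_le T _ _
  have hv' : Tendsto (fun n => E n (hG.yosida (hh n) x)) atTop (𝓝 v) := by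
    have h1 := (hlimR y).add hv
    simp only [zero_add] at h1
    refine h1.congr fun n => ?_
    rw [hG.yosida_apply_fst (hh n) hxy]
    exact sub_add_cancel _ _
  have hu' : Tendsto (fun n => E n (hG.resolvent (hh n) x)) atTop (𝓝 u) := by
    have h1 := (hlimR x).add hu
    simp only [zero_add] at h1
    refine h1.congr fun n => ?_
    exact sub_add_cancel _ _
  have heval : ∀ (t : Icc 0 T) {w : ℕ → C(Icc 0 T, H)} {z : C(Icc 0 T, H)},
      Tendsto w atTop (𝓝 z) → Tendsto (fun n => w n t) atTop (𝓝 (z t)) := fun t w z hw =>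
    ((continuous_eval_const t).tendsto z).comp hw
  refine ⟨u, v, fun t => ?_, hasDerivWithinAt_of_eq_add_integral hT (x := x) fun t => ?_, ?_, ?_⟩
  -- `u t` itself is approximated by orbit values outside the domain; applying the resolvent to them
  -- gives pairs in `G` with the same limit.
  · refine hG.isClosed.mem_of_tendsto ((heval t hu').prodMk_nhds (heval t hv'))
      (Eventually.of_forall fun n => ?_)
    have h1 := hG.resolvent_yosida_mem (hh n) (E n x t)
    have h2 : hG.resolvent (hh n) (E n x t) = E n (hG.resolvent (hh n) x) t :=
      exp_apply_comm (hG.commute_resolvent_yosida (hh n)).symm t x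
    have h3 : hG.yosida (hh n) (E n x t) = E n (hG.yosida (hh n) x) t :=
      exp_apply_comm (Commute.refl _) t x
    rwa [h2, h3] at h1
  · refine tendsto_nhds_unique (heval t hu) ?_
    refine ((((continuous_integral_IccExtend hT t).tendsto v).comp hv').const_add x).congr
      fun n => ?_
    exact (orbit_eq_add_integral hT (hG.inner_yosida_le (hh n)) x t).symm
  · refine tendsto_nhds_unique (heval _ hu) (tendsto_const_nhds.congr fun n => ?_)
    simp [orbit_apply]
  · intro Y hYc hY hx t
    refine hYc.mem_of_tendsto (heval t hu) (Eventually.of_forall fun n => ?_)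
    -- The Yosida approximation is `h⁻¹ (R - 1)`, so it preserves any subspace that `R` preserves.
    refine exp_apply_mem hYc (fun z hz => ?_) t hx
    rw [yosida_apply]
    refine Y.smul_mem _ (Y.sub_mem (hY _ (hh n) (hG.resolvent (hh n) z, hG.yosida (hh n) z)
      (hG.resolvent_yosida_mem (hh n) z) ?_) hz)
    rwa [hG.resolvent_sub_smul_yosida]

end IsSkewGenerator

omit [CompleteSpace H] in
-- The derivative of `‖u‖²` is `2⟪u, v⟫ = 0`. Applied to a solution this gives the norm bound;
-- applied to a difference it gives uniqueness.
lemma norm_eq_of_inner_eq_zero {T : ℝ} (hT : 0 < T) {u : C(Icc 0 T, H)} {v : Icc 0 T → H}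
    (huv : ∀ t : Icc 0 T, HasDerivWithinAt (IccExtend hT.le u) (v t) (Icc 0 T) t)
    (hskew : ∀ t, ⟪v t, u t⟫_ℝ = 0) (t : Icc 0 T) :
    ‖u t‖ = ‖u ⟨0, left_mem_Icc.2 hT.le⟩‖ := by
  have h1 : ∀ s ∈ Icc 0 T, HasDerivWithinAt (fun r => ‖IccExtend hT.le u r‖ ^ 2) 0 (Icc 0 T) s := by
    intro s hs
    have h2 := (huv ⟨s, hs⟩).norm_sq
    simp only [IccExtend_of_mem _ _ hs] at h2
    rwa [real_inner_comm, hskew, mul_zero] at h2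
  have h3 := norm_image_sub_le_of_norm_deriv_le_segment' (C := 0) h1
    (fun _ _ => norm_zero.le) t t.2
  rw [zero_mul, norm_le_zero_iff, sub_eq_zero, IccExtend_val,
    IccExtend_of_mem _ _ (left_mem_Icc.2 hT.le)] at h3
  exact (sq_eq_sq₀ (norm_nonneg _) (norm_nonneg _)).1 h3

end SkewGenerator

/-! ### Surjectivity from the complex property. -/

namespace SkewGenerator

open scoped InnerProductSpace

variable {H : Type*} [NormedAddCommGroup H] [InnerProductSpace ℝ H] [CompleteSpace H]

/-- If `g` is the graph of a closed operator `d` with `d ∘ d = 0`, then `1 + c (d - d*)` is onto. -/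
theorem exists_add_smul_sub_adjoint_eq {g : Submodule ℝ (H × H)} (hg : IsClosed (g : Set (H × H)))
    (hgg : ∀ p ∈ g, (p.2, (0 : H)) ∈ g) {c : ℝ} (hc : c ≠ 0) (f : H) :
    ∃ x a b : H, (x, a) ∈ g ∧ (x, b) ∈ g.adjoint ∧ x + c • (a - b) = f := by
  let ι : H →ₗ[ℝ] H × H := LinearMap.inl ℝ H H
  let K : Submodule ℝ H := g.comap ι
  have hK : IsClosed (K : Set H) := hg.preimage (by fun_prop : Continuous fun x : H => (x, (0 : H)))
  have : CompleteSpace K := hK.completeSpace_coe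
  let Φ : WithLp 2 (H × H) →ₗ[ℝ] H × H :=
    (LinearMap.id.prodMap (c⁻¹ • LinearMap.id)) ∘ₗ (WithLp.linearEquiv 2 ℝ (H × H)).toLinearMap
  let N : Submodule ℝ (WithLp 2 (H × H)) := g.comap Φ
  have hN : IsClosed (N : Set (WithLp 2 (H × H))) := hg.preimage (by
    change Continuous fun q : WithLp 2 (H × H) => ((WithLp.ofLp q).1, c⁻¹ • (WithLp.ofLp q).2)
    fun_prop)
  have : CompleteSpace N := hN.completeSpace_coe
  -- `K` is `ker d` and `N` is the graph of `c d`. Projecting `(f₁, f₂)` onto `N` gives `f₁ = x + p`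
  -- and `f₂ = c d x + y`, where orthogonality to `N` says `d* y = -c⁻¹ p`.
  obtain ⟨f₂, hf₂, f₁, hf₁, hf⟩ := K.exists_add_mem_mem_orthogonal f
  obtain ⟨q, hq, r, hr, hqr⟩ := N.exists_add_mem_mem_orthogonal (WithLp.toLp 2 (f₁, f₂))
  obtain ⟨⟨x, a'⟩, rfl⟩ := WithLp.toLp_surjective 2 q
  obtain ⟨⟨p, y⟩, rfl⟩ := WithLp.toLp_surjective 2 r
  have hx : x + p = f₁ := (congrArg (fun z => (WithLp.ofLp z).1) hqr).symm
  have hy : a' + y = f₂ := (congrArg (fun z => (WithLp.ofLp z).2) hqr).symm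
  have hxa : (x, c⁻¹ • a') ∈ g := hq
  have hyp : ∀ w w' : H, (w, w') ∈ g → ⟪w', y⟫_ℝ = ⟪w, (-c⁻¹) • p⟫_ℝ := by
    intro w w' hw
    have h1 := (Submodule.mem_orthogonal N _).1 hr (WithLp.toLp 2 (w, c • w')) (by
      change (w, c⁻¹ • c • w') ∈ g
      rwa [inv_smul_smul₀ hc])
    simp only [WithLp.prod_inner_apply, real_inner_smul_left] at h1
    rw [inner_smul_right]
    field_simp
    linarith
  have hya : (c⁻¹ • a', (0 : H)) ∈ g := hgg _ hxa
  have hyg : (y, (0 : H)) ∈ g := by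
    have h1 := g.sub_mem hf₂ (g.smul_mem c hya)
    simpa [ι, smul_inv_smul₀ hc, ← hy] using h1
  -- `y` lies in `ker d` because `f₂` and `d x` do. Moreover `d* x = 0`, since `f₁` and `p` are
  -- orthogonal to `ker d`, which contains the range of `d`.
  refine ⟨x + y, c⁻¹ • a', (-c⁻¹) • p, ?_, ?_, ?_⟩
  · simpa using g.add_mem hxa hyg
  · rw [Submodule.mem_adjoint_iff]
    intro w w' hw
    have h1 : ⟪w', f₁⟫_ℝ = 0 := (Submodule.mem_orthogonal K _).1 hf₁ w' (hgg _ hw)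
    have h2 := hyp w' 0 (hgg _ hw)
    rw [inner_zero_left, inner_smul_right, zero_eq_mul, neg_eq_zero, inv_eq_zero] at h2
    have h3 : ⟪w', x⟫_ℝ = 0 := by
      rw [← hx, inner_add_right, h2.resolve_left hc, add_zero] at h1
      exact h1
    simp only
    rw [inner_add_right, h3, hyp w w' hw]
    ring
  · rw [smul_sub, smul_inv_smul₀ hc, neg_smul, smul_neg, smul_inv_smul₀ hc, hf, ← hx, ← hy]
    abel

end SkewGenerator

/-! ### The complex property and closedness for the distributional operators. -/

noncomputable section

namespace DivDiv

open scoped InnerProductSpace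

variable {Ω : Opens Vec}

section Distributions

lemma testFunction_lineDeriv_comm (a b : Vec) (φ : 𝓓(Ω, ℝ)) : ∂_{a} (∂_{b} φ) = ∂_{b} (∂_{a} φ) := by
  have h1 : ∀ (v : Vec) (ψ : 𝓓(Ω, ℝ)) (x : Vec), (∂_{v} ψ : 𝓓(Ω, ℝ)) x = fderiv ℝ ψ x v := fun v ψ x => by
    rw [TestFunction.lineDerivOp_eq_lineDerivCLM ℝ, TestFunction.lineDerivCLM_eq_fderivCLM,
      TestFunction.fderivCLM_apply_of_le _ le_top]
  have h2 : ∀ (v w x : Vec), (∂_{w} (∂_{v} φ) : 𝓓(Ω, ℝ)) x = fderiv ℝ (fderiv ℝ φ) x w v := fun v w x => by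
    have h3 : ((∂_{v} φ : 𝓓(Ω, ℝ)) : Vec → ℝ) = fun y => fderiv ℝ φ y v := funext (h1 v φ)
    have h4 : ContDiff ℝ 1 (fderiv ℝ φ) :=
      (contDiff_infty.1 φ.contDiff 2).fderiv_right (by norm_num)
    rw [h1, h3, fderiv_clm_apply (h4.differentiable one_ne_zero x) (differentiableAt_const v)]
    simp
  ext x
  rw [h2, h2]
  have h5 : ContDiffAt ℝ 2 φ x := (contDiff_infty.1 φ.contDiff 2).contDiffAt
  exact h5.isSymmSndFDerivAt (by simp) a b

lemma lineDeriv_comm (a b : Vec) (u : 𝓓'(Ω, ℝ)) : ∂_{a} (∂_{b} u) = ∂_{b} (∂_{a} u) := by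
  ext φ
  simp only [Distribution.lineDerivOp_apply_apply, lineDerivOp_neg, testFunction_lineDeriv_comm a b]

lemma curl_grad (v : Fin 3 → 𝓓'(Ω, ℝ)) : curl (grad v) = 0 := by
  refine Matrix.ext fun i j => ?_
  simp only [curl, grad, Matrix.of_apply, Matrix.zero_apply]
  rw [lineDeriv_comm, sub_self]

/-- The curl of a scalar multiple of the identity is skew-symmetric; hence `dev` is invisible to
`sym curl` of a gradient. -/
lemma sym_curl_diagonal (p : 𝓓'(Ω, ℝ)) : sym (curl (Matrix.diagonal fun _ => p)) = 0 := by
  refine Matrix.ext fun i j => ?_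
  fin_cases i <;> fin_cases j <;> simp [sym, curl, Matrix.diagonal, lineDerivOp_zero]

lemma sym_curl_dev_grad (v : Fin 3 → 𝓓'(Ω, ℝ)) : sym (curl (dev (grad v))) = 0 := by
  rw [dev, sub_eq_add_neg, curl_add, curl_grad, zero_add, ← neg_one_smul ℝ, curl_smul, sym_smul,
    sym_curl_diagonal, smul_zero]

lemma div_curl (M : Matrix (Fin 3) (Fin 3) 𝓓'(Ω, ℝ)) : div (curl M) = 0 := by
  funext j
  simp only [div, curl, Matrix.of_apply, Fin.sum_univ_three, sub_eq_add_neg, lineDerivOp_add,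
    lineDerivOp_neg, Pi.zero_apply]
  simp only [Fin.isValue, zero_add, Fin.reduceAdd]
  rw [lineDeriv_comm (e 1) (e 0), lineDeriv_comm (e 2) (e 0), lineDeriv_comm (e 2) (e 1)]
  abel

lemma divdiv_transpose (M : Matrix (Fin 3) (Fin 3) 𝓓'(Ω, ℝ)) : divdiv M.transpose = divdiv M := by
  simp only [divdiv, div, lineDerivOp_sum, Matrix.transpose_apply]
  rw [Finset.sum_comm]
  exact Finset.sum_congr rfl fun i _ => Finset.sum_congr rfl fun j _ => lineDeriv_comm _ _ _

/-- `div div` does not see transposition, so the symmetrization drops out and `div curl = 0`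
remains. -/
lemma divdiv_sym_curl (M : Matrix (Fin 3) (Fin 3) 𝓓'(Ω, ℝ)) : divdiv (sym (curl M)) = 0 := by
  rw [sym, divdiv_smul, divdiv_add, divdiv_transpose, divdiv, div_curl]
  simp [lineDerivOp_zero]

end Distributions

section Continuity

variable {E : Type} [NormedAddCommGroup E] [NormedSpace ℝ E]

lemma component_apply (ℓ : E →L[ℝ] ℝ) (u : L2 Ω E) (φ : 𝓓(Ω, ℝ)) :
    component ℓ u φ = ∫ x in (Ω : Set Vec), φ x * ℓ (u x) := regular_apply ℓ u φ

lemma testFunction_memLp (φ : 𝓓(Ω, ℝ)) : MemLp φ 2 (volume.restrict (Ω : Set Vec)) :=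
  φ.continuous.memLp_of_hasCompactSupport φ.hasCompactSupport

@[fun_prop]
-- The pairing with `φ` is an `L²` inner product. Since distributional derivatives fall on `φ`, each
-- operator graph becomes an intersection of closed conditions, one per test function and entry.
lemma continuous_component_apply (ℓ : E →L[ℝ] ℝ) (φ : 𝓓(Ω, ℝ)) :
    Continuous fun u : L2 Ω E => component ℓ u φ := by
  have h1 : (fun u : L2 Ω E => component ℓ u φ) = fun u =>
      ⟪(ℓ.compLpL 2 (volume.restrict (Ω : Set Vec)) u : L2 Ω ℝ), (testFunction_memLp φ).toLp φ⟫_ℝ := by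
    funext u
    rw [component_apply, L2.inner_def]
    refine integral_congr_ae ?_
    filter_upwards [ℓ.coeFn_compLpL u, (testFunction_memLp φ).coeFn_toLp] with x h2 h3
    rw [h2, h3]
    simp
  rw [h1]
  fun_prop

end Continuity

lemma isClosed_devGradGraph : IsClosed (devGradGraph Ω : Set (L2 Ω Vec × L2 Ω TraceFree)) := by
  have h1 : (devGradGraph Ω : Set (L2 Ω Vec × L2 Ω TraceFree)) = ⋂ (i : Fin 3) (j : Fin 3) (φ : 𝓓(Ω, ℝ)),
      {p | matDist p.2 i j φ = dev (grad (vecDist p.1)) i j φ} := by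
    ext p
    simp only [mem_iInter]
    refine ⟨fun h i j φ => ?_, fun h =>
      Matrix.ext fun i j => ContinuousLinearMap.ext fun φ => h i j φ⟩
    exact congrArg (fun D : 𝓓'(Ω, ℝ) => D φ) (congrFun (congrFun h i) j)
  rw [h1]
  refine isClosed_iInter fun i => isClosed_iInter fun j => isClosed_iInter fun φ => isClosed_eq ?_ ?_
  · simp only [matDist, Matrix.of_apply]; fun_prop
  · by_cases h : i = j
    · simp only [dev, h, grad, vecDist, Matrix.trace, Matrix.sub_apply, Matrix.diagonal_apply_eq,
        Matrix.diag_apply, Matrix.of_apply, Fin.sum_univ_three, sub_apply, smul_apply, add_apply,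
        Distribution.lineDerivOp_apply_apply]
      fun_prop
    · simp only [dev, grad, vecDist, Matrix.sub_apply, Matrix.diagonal_apply_ne _ h, sub_zero,
        Matrix.of_apply, Distribution.lineDerivOp_apply_apply]
      fun_prop

lemma isClosed_symCurlGraph : IsClosed (symCurlGraph Ω : Set (L2 Ω TraceFree × L2 Ω Symm)) := by
  have h1 : (symCurlGraph Ω : Set (L2 Ω TraceFree × L2 Ω Symm)) = ⋂ (i : Fin 3) (j : Fin 3) (φ : 𝓓(Ω, ℝ)),
      {p | matDist p.2 i j φ = sym (curl (matDist p.1)) i j φ} := by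
    ext p
    simp only [mem_iInter]
    refine ⟨fun h i j φ => ?_, fun h =>
      Matrix.ext fun i j => ContinuousLinearMap.ext fun φ => h i j φ⟩
    exact congrArg (fun D : 𝓓'(Ω, ℝ) => D φ) (congrFun (congrFun h i) j)
  rw [h1]
  refine isClosed_iInter fun i => isClosed_iInter fun j => isClosed_iInter fun φ => isClosed_eq ?_ ?_
  · simp only [matDist, Matrix.of_apply]; fun_prop
  · simp only [sym, curl, matDist, Matrix.smul_apply, Matrix.add_apply, Matrix.transpose_apply,
      Matrix.of_apply, smul_apply, add_apply, sub_apply, Distribution.lineDerivOp_apply_apply]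
    fun_prop

lemma isClosed_divDivGraph : IsClosed (divDivGraph Ω : Set (L2 Ω Symm × L2 Ω ℝ)) := by
  have h1 : (divDivGraph Ω : Set (L2 Ω Symm × L2 Ω ℝ)) = ⋂ φ : 𝓓(Ω, ℝ),
      {p | scalDist p.2 φ = divdiv (matDist p.1) φ} := by
    ext p
    simp only [mem_iInter]
    exact ⟨fun h φ => congrArg (fun D : 𝓓'(Ω, ℝ) => D φ) h,
      fun h => ContinuousLinearMap.ext fun φ => h φ⟩
  rw [h1]
  refine isClosed_iInter fun φ => isClosed_eq ?_ ?_
  · simp only [scalDist]; fun_prop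
  · simp only [divdiv, div, matDist, Matrix.of_apply, Fin.sum_univ_three, add_apply,
      Distribution.lineDerivOp_apply_apply]
    fun_prop

end DivDiv

end

/-! ### Test fields and the adjoint of `dev grad`. -/

noncomputable section

namespace DivDiv

open scoped InnerProductSpace

variable {Ω : Opens Vec}

section TestFunctions

variable {E : Type} [NormedAddCommGroup E] [InnerProductSpace ℝ E]

/-- The square-integrable field `φ v` for a test function `φ` and a constant `v`. -/
def testField (φ : 𝓓(Ω, ℝ)) (v : E) : L2 Ω E :=
  (((ContinuousLinearMap.id ℝ ℝ).smulRight v).comp_memLp' (testFunction_memLp φ)).toLp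

lemma coeFn_testField (φ : 𝓓(Ω, ℝ)) (v : E) :
    testField φ v =ᵐ[volume.restrict (Ω : Set Vec)] fun x => φ x • v :=
  MemLp.coeFn_toLp _

lemma inner_testField (φ : 𝓓(Ω, ℝ)) (v : E) (u : L2 Ω E) :
    ⟪testField φ v, u⟫_ℝ = component (innerSL ℝ v) u φ := by
  rw [L2.inner_def, component_apply]
  refine integral_congr_ae ?_
  filter_upwards [coeFn_testField φ v] with x hx
  rw [hx, inner_smul_left]
  rfl

/-- The distribution defined by a test function. -/
def testDist (φ : 𝓓(Ω, ℝ)) : 𝓓'(Ω, ℝ) := scalDist (testField φ (1 : ℝ))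

lemma testDist_apply (φ ψ : 𝓓(Ω, ℝ)) : testDist φ ψ = ∫ x in (Ω : Set Vec), ψ x * φ x := by
  rw [testDist, scalDist, component_apply]
  refine integral_congr_ae ?_
  filter_upwards [coeFn_testField φ (1 : ℝ)] with x hx
  simp [hx]

lemma component_testField (ℓ : E →L[ℝ] ℝ) (φ : 𝓓(Ω, ℝ)) (v : E) :
    component ℓ (testField φ v) = ℓ v • testDist φ := by
  ext ψ
  rw [smul_apply, testDist_apply, component_apply, smul_eq_mul, ← integral_const_mul]
  refine integral_congr_ae ?_
  filter_upwards [coeFn_testField φ v] with x hx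
  rw [hx, map_smul, smul_eq_mul]
  ring

lemma lineDeriv_testDist (a : Vec) (φ : 𝓓(Ω, ℝ)) : ∂_{a} (testDist φ) = testDist (∂_{a} φ) := by
  -- Test functions vanish outside `Ω`, so the integration by parts can be done on the whole space
  -- without boundary terms.
  have hsupp : ∀ f g : 𝓓(Ω, ℝ), ∫ x in (Ω : Set Vec), f x * g x = ∫ x, f x * g x := fun f g =>
    setIntegral_eq_integral_of_forall_compl_eq_zero fun x hx => by
      rw [image_eq_zero_of_notMem_tsupport fun h => hx (f.tsupport_subset h), zero_mul]
  have hint : ∀ f g : 𝓓(Ω, ℝ), Integrable fun x => f x * g x := fun f g =>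
    (f.continuous.mul g.continuous).integrable_of_hasCompactSupport f.hasCompactSupport.mul_right
  have hder : ∀ (f : 𝓓(Ω, ℝ)) (x : Vec), HasLineDerivAt ℝ f ((∂_{a} f : 𝓓(Ω, ℝ)) x) x a := fun f x => by
    rw [TestFunction.lineDerivOp_eq_lineDerivCLM ℝ, TestFunction.lineDerivCLM_apply_of_le le_top]
    exact ((contDiff_infty.1 f.contDiff 1).differentiable one_ne_zero x).lineDifferentiableAt.hasLineDerivAt
  ext ψ
  rw [Distribution.lineDerivOp_apply_apply, map_neg, testDist_apply, testDist_apply, hsupp, hsupp]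
  have h := integral_bilinear_hasLineDerivAt_right_eq_neg_left_of_integrable
    (B := ContinuousLinearMap.mul ℝ ℝ) (μ := (volume : Measure Vec)) (f := ψ) (g := φ) (v := a)
    (f' := (∂_{a} ψ : 𝓓(Ω, ℝ))) (g' := (∂_{a} φ : 𝓓(Ω, ℝ)))
    (hint _ _) (hint _ _) (hint _ _) (fun x _ => hder ψ x) (fun x _ => hder φ x)
  exact h.symm

/-- The trace-free part of the `(i, j)` matrix unit. -/
def unitTraceFree (i j : Fin 3) : TraceFree :=
  ⟨WithLp.toLp 2 fun p => (if p = (i, j) then 1 else 0) - if p.1 = p.2 ∧ i = j then 1 / 3 else 0, by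
    change ∑ k, ((if (k, k) = (i, j) then (1 : ℝ) else 0) - if k = k ∧ i = j then 1 / 3 else 0) = 0
    fin_cases i <;> fin_cases j <;> norm_num [Fin.sum_univ_three]⟩

lemma unitTraceFree_apply (i j k l : Fin 3) : (unitTraceFree i j : Mat) (k, l) =
    (if (k, l) = (i, j) then 1 else 0) - if k = l ∧ i = j then 1 / 3 else 0 := rfl

/-- Removing the trace part of the matrix unit changes nothing, because multiples of the identity
are orthogonal to trace-free matrices. -/
lemma inner_unitTraceFree (i j : Fin 3) (M : TraceFree) :
    ⟪unitTraceFree i j, M⟫_ℝ = (M : Mat) (i, j) := by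
  have h1 : ∑ k, (M : Mat) (k, k) = 0 := M.2
  change ⟪(unitTraceFree i j : Mat), (M : Mat)⟫_ℝ = _
  rw [PiLp.inner_apply, Fintype.sum_prod_type]
  simp only [unitTraceFree_apply, Fin.sum_univ_three] at h1 ⊢
  fin_cases i <;> fin_cases j <;> simp <;> linarith

lemma testField_mem_devGradGraph (φ : 𝓓(Ω, ℝ)) (j : Fin 3) :
    (testField φ (e j), ∑ i, testField (∂_{e i} φ) (unitTraceFree i j)) ∈ devGradGraph Ω := by
  change matDist _ = dev (grad (vecDist _))
  refine Matrix.ext fun k l => ?_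
  have h1 : ∀ k l, grad (vecDist (testField φ (e j))) k l =
      if l = j then testDist (∂_{e k} φ) else 0 := fun k l => by
    rw [grad, Matrix.of_apply, vecDist, component_testField, lineDerivOp_smul, lineDeriv_testDist]
    by_cases h : l = j <;> simp [e, h]
  have h2 : matDist (∑ i, testField (∂_{e i} φ) (unitTraceFree i j)) k l =
      ∑ i, (unitTraceFree i j : Mat) (k, l) • testDist (∂_{e i} φ) := by
    rw [matDist, Matrix.of_apply, map_sum]
    exact Finset.sum_congr rfl fun i _ => component_testField _ _ _
  rw [h2, dev, Matrix.sub_apply, h1, Matrix.trace, Matrix.diagonal_apply]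
  simp only [Matrix.diag_apply, h1, unitTraceFree_apply, Fin.sum_univ_three]
  fin_cases j <;> fin_cases k <;> fin_cases l <;> simp [sub_smul]

lemma vecDist_eq_zero (u : L2 Ω Vec) (h : vecDist u = 0) : u = 0 := by
  rw [Lp.eq_zero_iff_ae_eq_zero]
  have h1 : ∀ j : Fin 3, ∀ᵐ x ∂(volume.restrict (Ω : Set Vec)), u x j = 0 :=
    fun j => component_eq_zero Ω (EuclideanSpace.proj j) u (congrFun h j)
  filter_upwards [ae_all_iff.2 h1] with x hx
  ext j
  exact hx j

/-- The adjoint of `dev grad` vanishes where the distributional divergence does. -/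
lemma eq_zero_of_div_eq_zero {A : L2 Ω TraceFree} {z : L2 Ω Vec}
    (hz : (A, z) ∈ (devGradGraph Ω).adjoint) (hA : div (matDist A) = 0) : z = 0 := by
  refine vecDist_eq_zero z ?_
  funext j
  ext φ
  -- Testing the adjoint relation with `φ eⱼ` identifies the `j`-th component of `z` with minus that
  -- of the weak divergence.
  have h1 := (Submodule.mem_adjoint_iff _ _).1 hz _ _ (testField_mem_devGradGraph φ j)
  have h2 : ⟪testField φ (e j), z⟫_ℝ = vecDist z j φ := by
    have h4 : innerSL ℝ (e j) = EuclideanSpace.proj j := by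
      ext x
      simp [e, EuclideanSpace.inner_single_left]
    rw [inner_testField, vecDist, h4]
  have h3 : ⟪∑ i, testField (∂_{e i} φ) (unitTraceFree i j), A⟫_ℝ = -(div (matDist A) j φ) := by
    rw [sum_inner, div, sum_apply, ← Finset.sum_neg_distrib]
    refine Finset.sum_congr rfl fun i _ => ?_
    have h4 : innerSL ℝ (unitTraceFree i j) =
        (EuclideanSpace.proj (i, j)).comp TraceFree.subtypeL :=
      ContinuousLinearMap.ext fun M => inner_unitTraceFree i j M
    rw [inner_testField, Distribution.lineDerivOp_apply_apply, map_neg, neg_neg, matDist,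
      Matrix.of_apply, h4]
  simp only at h1
  rw [h2, h3, hA] at h1
  simpa using h1

end TestFunctions

end DivDiv

end

/-! ### Graphs of `d`, its adjoint and `𝓛` in components. -/

noncomputable section

namespace DivDiv

open scoped InnerProductSpace

variable {Ω : Opens Vec}

section Space

lemma X.ext {U V : X Ω} (h₀ : X.c₀ U = X.c₀ V) (h₁ : X.c₁ U = X.c₁ V) (h₂ : X.c₂ U = X.c₂ V)
    (h₃ : X.c₃ U = X.c₃ V) : U = V :=
  WithLp.ofLp_injective 2 (Prod.ext h₀ (WithLp.ofLp_injective 2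
    (Prod.ext h₁ (WithLp.ofLp_injective 2 (Prod.ext h₂ h₃)))))

section mk

variable (a : L2 Ω Vec) (A : L2 Ω TraceFree) (B : L2 Ω Symm) (b : L2 Ω ℝ)

@[simp] lemma X.c₀_mk : X.c₀ (X.mk a A B b) = a := rfl
@[simp] lemma X.c₁_mk : X.c₁ (X.mk a A B b) = A := rfl
@[simp] lemma X.c₂_mk : X.c₂ (X.mk a A B b) = B := rfl
@[simp] lemma X.c₃_mk : X.c₃ (X.mk a A B b) = b := rfl

end mk

lemma X.inner_eq (U V : X Ω) : ⟪U, V⟫_ℝ =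
    ⟪X.c₀ U, X.c₀ V⟫_ℝ + (⟪X.c₁ U, X.c₁ V⟫_ℝ + (⟪X.c₂ U, X.c₂ V⟫_ℝ + ⟪X.c₃ U, X.c₃ V⟫_ℝ)) := rfl

lemma X.continuous_c₀ : Continuous (X.c₀ : X Ω → L2 Ω Vec) :=
  (WithLp.prod_continuous_ofLp 2 _ _).fst

lemma X.continuous_c₁ : Continuous (X.c₁ : X Ω → L2 Ω TraceFree) :=
  ((WithLp.prod_continuous_ofLp 2 _ _).comp (WithLp.prod_continuous_ofLp 2 _ _).snd).fst

lemma X.continuous_c₂ : Continuous (X.c₂ : X Ω → L2 Ω Symm) :=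
  ((WithLp.prod_continuous_ofLp 2 _ _).comp ((WithLp.prod_continuous_ofLp 2 _ _).comp
    (WithLp.prod_continuous_ofLp 2 _ _).snd).snd).fst

lemma X.continuous_c₃ : Continuous (X.c₃ : X Ω → L2 Ω ℝ) :=
  ((WithLp.prod_continuous_ofLp 2 _ _).comp ((WithLp.prod_continuous_ofLp 2 _ _).comp
    (WithLp.prod_continuous_ofLp 2 _ _).snd).snd).snd

lemma X.continuous_mk : Continuous fun p : L2 Ω Vec × L2 Ω TraceFree × L2 Ω Symm × L2 Ω ℝ =>
    X.mk p.1 p.2.1 p.2.2.1 p.2.2.2 :=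
  (WithLp.prod_continuous_toLp 2 _ _).comp (continuous_fst.prodMk
    ((WithLp.prod_continuous_toLp 2 _ _).comp (continuous_snd.fst.prodMk
      ((WithLp.prod_continuous_toLp 2 _ _).comp continuous_snd.snd))))

@[simp] lemma c₀_J (U : X Ω) : X.c₀ (J Ω U) = X.c₀ U := rfl
@[simp] lemma c₁_J (U : X Ω) : X.c₁ (J Ω U) = -X.c₁ U := rfl
@[simp] lemma c₂_J (U : X Ω) : X.c₂ (J Ω U) = X.c₂ U := rfl
@[simp] lemma c₃_J (U : X Ω) : X.c₃ (J Ω U) = -X.c₃ U := rfl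

@[simp] lemma J_J (U : X Ω) : J Ω (J Ω U) = U := by
  apply X.ext <;> simp

lemma inner_J_left (U V : X Ω) : ⟪J Ω U, V⟫_ℝ = ⟪U, J Ω V⟫_ℝ := by
  simp [X.inner_eq]

lemma continuous_J : Continuous (J Ω) := by
  refine X.continuous_mk.comp (X.continuous_c₀.prodMk (X.continuous_c₁.neg.prodMk
    (X.continuous_c₂.prodMk X.continuous_c₃.neg)))

end Space

section Graphs

lemma graph_devGrad : (devGrad Ω).graph = devGradGraph Ω :=
  Submodule.toLinearPMap_graph_eq _ (devGradGraph_single Ω)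

lemma graph_symCurl : (symCurl Ω).graph = symCurlGraph Ω :=
  Submodule.toLinearPMap_graph_eq _ (symCurlGraph_single Ω)

lemma graph_divDiv : (divDiv Ω).graph = divDivGraph Ω :=
  Submodule.toLinearPMap_graph_eq _ (divDivGraph_single Ω)

lemma mem_graph_d {p : X Ω × X Ω} : p ∈ (d Ω).graph ↔
    X.c₀ p.2 = 0 ∧ (X.c₀ p.1, X.c₁ p.2) ∈ devGradGraph Ω ∧
      (X.c₁ p.1, X.c₂ p.2) ∈ symCurlGraph Ω ∧ (X.c₂ p.1, X.c₃ p.2) ∈ divDivGraph Ω := by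
  rw [← graph_devGrad, ← graph_symCurl, ← graph_divDiv]
  simp only [LinearPMap.mem_graph_iff, Subtype.exists, exists_and_left, exists_eq_left]
  constructor
  · rintro ⟨h, h'⟩
    rw [← h']
    exact ⟨rfl, ⟨h.1.1, rfl⟩, ⟨h.1.2, rfl⟩, ⟨h.2, rfl⟩⟩
  · rintro ⟨h₀, ⟨h₁, h₁'⟩, ⟨h₂, h₂'⟩, ⟨h₃, h₃'⟩⟩
    exact ⟨⟨⟨h₁, h₂⟩, h₃⟩, X.ext h₀.symm h₁' h₂' h₃'⟩

lemma isClosed_graph_d : IsClosed ((d Ω).graph : Set (X Ω × X Ω)) := by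
  have h : ((d Ω).graph : Set (X Ω × X Ω)) = {p | X.c₀ p.2 = 0} ∩
      ((fun p : X Ω × X Ω => (X.c₀ p.1, X.c₁ p.2)) ⁻¹' devGradGraph Ω ∩
      ((fun p : X Ω × X Ω => (X.c₁ p.1, X.c₂ p.2)) ⁻¹' symCurlGraph Ω ∩
      (fun p : X Ω × X Ω => (X.c₂ p.1, X.c₃ p.2)) ⁻¹' divDivGraph Ω)) :=
    Set.ext fun p => mem_graph_d
  rw [h]
  have h₀ := X.continuous_c₀ (Ω := Ω)
  have h₁ := X.continuous_c₁ (Ω := Ω)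
  have h₂ := X.continuous_c₂ (Ω := Ω)
  have h₃ := X.continuous_c₃ (Ω := Ω)
  exact (isClosed_eq (h₀.comp continuous_snd) continuous_const).inter
    ((isClosed_devGradGraph.preimage ((h₀.comp continuous_fst).prodMk (h₁.comp continuous_snd))).inter
    ((isClosed_symCurlGraph.preimage ((h₁.comp continuous_fst).prodMk (h₂.comp continuous_snd))).inter
    (isClosed_divDivGraph.preimage ((h₂.comp continuous_fst).prodMk (h₃.comp continuous_snd)))))

lemma devGradGraph_comp {u : L2 Ω Vec} {A : L2 Ω TraceFree} (h : (u, A) ∈ devGradGraph Ω) :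
    (A, (0 : L2 Ω Symm)) ∈ symCurlGraph Ω := by
  change matDist (0 : L2 Ω Symm) = sym (curl (matDist A))
  have h' : matDist A = dev (grad (vecDist u)) := h
  rw [h', sym_curl_dev_grad, matDist_zero]

lemma symCurlGraph_comp {A : L2 Ω TraceFree} {B : L2 Ω Symm} (h : (A, B) ∈ symCurlGraph Ω) :
    (B, (0 : L2 Ω ℝ)) ∈ divDivGraph Ω := by
  change scalDist (0 : L2 Ω ℝ) = divdiv (matDist B)
  have h' : matDist B = sym (curl (matDist A)) := h
  rw [h', divdiv_sym_curl, scalDist, map_zero]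

lemma graph_d_comp {U V : X Ω} (h : (U, V) ∈ (d Ω).graph) : (V, 0) ∈ (d Ω).graph := by
  obtain ⟨h₀, h₁, h₂, h₃⟩ := mem_graph_d.1 h
  simp only at h₀ h₁ h₂ h₃
  refine mem_graph_d.2 ⟨map_zero _, ?_, ?_, ?_⟩
  · simp only [h₀, map_zero]; exact zero_mem _
  · simpa using devGradGraph_comp h₁
  · simpa using symCurlGraph_comp h₂

/-- This is `d J = -J d`: the signs in `J` alternate and `d` shifts components by one. -/
lemma graph_d_J {U V : X Ω} (h : (U, V) ∈ (d Ω).graph) : (J Ω U, -J Ω V) ∈ (d Ω).graph := by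
  obtain ⟨h₀, h₁, h₂, h₃⟩ := mem_graph_d.1 h
  simp only at h₀ h₁ h₂ h₃
  refine mem_graph_d.2 ⟨?_, ?_, ?_, ?_⟩
  · simp [h₀]
  · simpa using h₁
  · simpa using (symCurlGraph Ω).neg_mem h₂
  · simpa using h₃

lemma mem_adjoint_graph_d {p : X Ω × X Ω} : p ∈ (d Ω).graph.adjoint ↔
    X.c₃ p.2 = 0 ∧ (X.c₁ p.1, X.c₀ p.2) ∈ (devGradGraph Ω).adjoint ∧
      (X.c₂ p.1, X.c₁ p.2) ∈ (symCurlGraph Ω).adjoint ∧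
      (X.c₃ p.1, X.c₂ p.2) ∈ (divDivGraph Ω).adjoint := by
  simp only [Submodule.mem_adjoint_iff]
  constructor
  · intro h
    have z₁ : ((0 : L2 Ω Vec), (0 : L2 Ω TraceFree)) ∈ devGradGraph Ω := zero_mem _
    have z₂ : ((0 : L2 Ω TraceFree), (0 : L2 Ω Symm)) ∈ symCurlGraph Ω := zero_mem _
    have z₃ : ((0 : L2 Ω Symm), (0 : L2 Ω ℝ)) ∈ divDivGraph Ω := zero_mem _
    refine ⟨?_, fun a b hab => ?_, fun a b hab => ?_, fun a b hab => ?_⟩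
    -- The last component of the argument of `d` is unrestricted and is sent to zero, which forces
    -- the last component of `d*` to vanish.
    · have := h (X.mk 0 0 0 (X.c₃ p.2)) 0 (mem_graph_d.2 (by simp [z₁, z₂, z₃]))
      simpa [X.inner_eq] using this
    · have := h (X.mk a 0 0 0) (X.mk 0 b 0 0) (mem_graph_d.2 (by simp [z₂, z₃, hab]))
      simpa [X.inner_eq] using this
    · have := h (X.mk 0 a 0 0) (X.mk 0 0 b 0) (mem_graph_d.2 (by simp [z₁, z₃, hab]))
      simpa [X.inner_eq] using this
    · have := h (X.mk 0 0 a 0) (X.mk 0 0 0 b) (mem_graph_d.2 (by simp [z₁, z₂, hab]))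
      simpa [X.inner_eq] using this
  · rintro ⟨h₃, h₀, h₁, h₂⟩ a b hab
    obtain ⟨k₀, k₁, k₂, k₃⟩ := mem_graph_d.1 hab
    have e₀ := h₀ _ _ k₁
    have e₁ := h₁ _ _ k₂
    have e₂ := h₂ _ _ k₃
    simp only at k₀ e₀ e₁ e₂
    rw [X.inner_eq, X.inner_eq, h₃, k₀, inner_zero_left, inner_zero_right]
    linarith

/-- `U` lies in the domain of the Hodge-Dirac operator and `V = 𝓛 U`. -/
lemma mem_graph_L (hd : Dense ((d Ω).domain : Set (X Ω))) {U V : X Ω} : (U, V) ∈ (L Ω).graph ↔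
    ∃ a b, (U, a) ∈ (d Ω).graph ∧ (U, b) ∈ (d Ω).graph.adjoint ∧ J Ω (a + b) = V := by
  rw [← LinearPMap.adjoint_graph_eq_graph_adjoint hd]
  constructor
  · intro h
    obtain ⟨⟨u, hu⟩, rfl, h'⟩ := (LinearPMap.mem_graph_iff _).1 h
    exact ⟨d Ω ⟨u, hu.1⟩, (d Ω)† ⟨u, hu.2⟩, LinearPMap.mem_graph (d Ω) ⟨u, hu.1⟩,
      LinearPMap.mem_graph (d Ω)† ⟨u, hu.2⟩, h'⟩
  · rintro ⟨a, b, h₁, h₂, h⟩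
    obtain ⟨⟨u, hu⟩, hu', h₁'⟩ := (LinearPMap.mem_graph_iff _).1 h₁
    obtain ⟨⟨w, hw⟩, hw', h₂'⟩ := (LinearPMap.mem_graph_iff _).1 h₂
    simp only at hu' h₁' hw' h₂'
    subst hu' hw'
    refine (LinearPMap.mem_graph_iff _).2 ⟨⟨_, hu, hw⟩, rfl, ?_⟩
    rw [← h, ← h₁', ← h₂']
    rfl

end Graphs

end DivDiv

end

/-! ### `𝓛` as a skew generator, and invariance of the constraints. -/

noncomputable section

namespace DivDiv

open scoped InnerProductSpace
open SkewGenerator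

variable {Ω : Opens Vec}

lemma dense_domain_d (hL : Dense ((L Ω).domain : Set (X Ω))) : Dense ((d Ω).domain : Set (X Ω)) :=
  hL.mono fun _ h => h.1

/-- A continuous surjective projection maps a dense set to a dense set. Density is what identifies
the graph of `LinearPMap.adjoint` with the adjoint relation. -/
lemma dense_domain_devGrad (hL : Dense ((L Ω).domain : Set (X Ω))) :
    Dense ((devGrad Ω).domain : Set (L2 Ω Vec)) := by
  have h : Function.Surjective (X.c₀ : X Ω → L2 Ω Vec) := fun u => ⟨X.mk u 0 0 0, rfl⟩
  refine (h.denseRange.dense_image X.continuous_c₀ (dense_domain_d hL)).mono ?_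
  rintro _ ⟨U, hU, rfl⟩
  exact hU.1.1

lemma dense_domain_symCurl (hL : Dense ((L Ω).domain : Set (X Ω))) :
    Dense ((symCurl Ω).domain : Set (L2 Ω TraceFree)) := by
  have h : Function.Surjective (X.c₁ : X Ω → L2 Ω TraceFree) := fun u => ⟨X.mk 0 u 0 0, rfl⟩
  refine (h.denseRange.dense_image X.continuous_c₁ (dense_domain_d hL)).mono ?_
  rintro _ ⟨U, hU, rfl⟩
  exact hU.1.2

lemma dense_domain_divDiv (hL : Dense ((L Ω).domain : Set (X Ω))) :
    Dense ((divDiv Ω).domain : Set (L2 Ω Symm)) := by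
  have h : Function.Surjective (X.c₂ : X Ω → L2 Ω Symm) := fun u => ⟨X.mk 0 0 u 0, rfl⟩
  refine (h.denseRange.dense_image X.continuous_c₂ (dense_domain_d hL)).mono ?_
  rintro _ ⟨U, hU, rfl⟩
  exact hU.2

lemma graph_devGradAdj (hL : Dense ((L Ω).domain : Set (X Ω))) :
    (devGradAdj Ω).graph = (devGradGraph Ω).adjoint := by
  rw [devGradAdj, LinearPMap.adjoint_graph_eq_graph_adjoint (dense_domain_devGrad hL), graph_devGrad]

lemma graph_symCurlAdj (hL : Dense ((L Ω).domain : Set (X Ω))) :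
    (symCurlAdj Ω).graph = (symCurlGraph Ω).adjoint := by
  rw [symCurlAdj, LinearPMap.adjoint_graph_eq_graph_adjoint (dense_domain_symCurl hL), graph_symCurl]

theorem isSkewGenerator_L (hL : Dense ((L Ω).domain : Set (X Ω))) :
    IsSkewGenerator (L Ω).graph where
  dense := by
    refine hL.mono fun U hU => ?_
    exact ⟨_, LinearPMap.mem_graph _ ⟨U, hU⟩⟩
  skew := by
    rintro ⟨U, V⟩ hUV
    obtain ⟨a, b, ha, hb, rfl⟩ := (mem_graph_L (dense_domain_d hL)).1 hUV
    -- Testing `b = d* U` against `d (J U) = -J a` gives `⟪J a, U⟫ = -⟪J U, b⟫`.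
    have h := (Submodule.mem_adjoint_iff _ _).1 hb _ _ (graph_d_J ha)
    simp only at h ⊢
    rw [inner_neg_left, inner_J_left] at h
    rw [inner_J_left, inner_add_left, real_inner_comm (J Ω U) b]
    linarith
  surj := by
    intro h hh f
    -- As `J² = 1`, this is the graph of `J d`. The range lemma is applied to it with `c = -h`.
    let g : Submodule ℝ (X Ω × X Ω) := (d Ω).graph.comap (LinearMap.id.prodMap (J Ω))
    have hg : ∀ U V, (U, V) ∈ g ↔ (U, J Ω V) ∈ (d Ω).graph := fun U V => Iff.rfl
    have hgc : IsClosed (g : Set (X Ω × X Ω)) :=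
      isClosed_graph_d.preimage (continuous_fst.prodMk (continuous_J.comp continuous_snd))
    have hgg : ∀ p ∈ g, (p.2, (0 : X Ω)) ∈ g := by
      rintro ⟨U, V⟩ hUV
      have := graph_d_J (graph_d_comp ((hg _ _).1 hUV))
      rw [J_J] at this
      rw [hg, map_zero]
      simpa using this
    obtain ⟨U, a, b, ha, hb, hf⟩ := exists_add_smul_sub_adjoint_eq hgc hgg (neg_ne_zero.2 hh.ne') f
    refine ⟨(U, a - b), ?_, by rw [← hf, neg_smul, sub_eq_add_neg]⟩
    refine (mem_graph_L (dense_domain_d hL)).2 ⟨J Ω a, -J Ω b, ha, ?_, by simp [sub_eq_add_neg]⟩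
    rw [Submodule.mem_adjoint_iff]
    intro w w' hw
    have h1 := (Submodule.mem_adjoint_iff _ _).1 hb (J Ω w) (-w') (by
      rw [hg, map_neg]; exact graph_d_J hw)
    simp only [inner_neg_left, inner_neg_right, inner_J_left] at h1 ⊢
    linarith

/-- Membership in the graph of `𝓛`, by components. -/
lemma mem_graph_L_iff (hL : Dense ((L Ω).domain : Set (X Ω))) {U V : X Ω} :
    (U, V) ∈ (L Ω).graph ↔ ∃ (a₁ b₁ : L2 Ω TraceFree) (a₂ b₂ : L2 Ω Symm),
      (X.c₁ U, X.c₀ V) ∈ (devGradGraph Ω).adjoint ∧ (X.c₀ U, a₁) ∈ devGradGraph Ω ∧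
      (X.c₂ U, b₁) ∈ (symCurlGraph Ω).adjoint ∧ (X.c₁ U, a₂) ∈ symCurlGraph Ω ∧
      (X.c₃ U, b₂) ∈ (divDivGraph Ω).adjoint ∧ (X.c₂ U, -X.c₃ V) ∈ divDivGraph Ω ∧
      X.c₁ V = -(a₁ + b₁) ∧ X.c₂ V = a₂ + b₂ := by
  rw [mem_graph_L (dense_domain_d hL)]
  constructor
  · rintro ⟨a, b, ha, hb, rfl⟩
    obtain ⟨h₀, h₁, h₂, h₃⟩ := mem_graph_d.1 ha
    obtain ⟨k₃, k₀, k₁, k₂⟩ := mem_adjoint_graph_d.1 hb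
    simp only at h₀ h₁ h₂ h₃ k₃ k₀ k₁ k₂
    exact ⟨X.c₁ a, X.c₁ b, X.c₂ a, X.c₂ b, by simpa [h₀] using k₀, h₁, k₁, h₂, k₂,
      by simpa [k₃] using h₃, by rw [c₁_J, map_add], by simp⟩
  · rintro ⟨a₁, b₁, a₂, b₂, h₀, h₁, h₂, h₃, h₄, h₅, h₆, h₇⟩
    refine ⟨X.mk 0 a₁ a₂ (-X.c₃ V), X.mk (X.c₀ V) b₁ b₂ 0, mem_graph_d.2 ⟨rfl, h₁, h₃, h₅⟩,
      mem_adjoint_graph_d.2 ⟨rfl, h₀, h₂, h₄⟩, ?_⟩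
    apply X.ext
    · simp
    · rw [c₁_J, map_add, h₆]; rfl
    · simp [h₇]
    · simp

/-- The fields `(0, A, B, 0)` with `div A = 0` and `div div B = 0`. -/
def constraintSpace (Ω : Opens Vec) : Submodule ℝ (X Ω) where
  carrier := {U | X.c₀ U = 0 ∧ X.c₃ U = 0 ∧ (X.c₁ U, (0 : L2 Ω Vec)) ∈ (devGradGraph Ω).adjoint ∧
    (X.c₂ U, (0 : L2 Ω ℝ)) ∈ divDivGraph Ω}
  add_mem' {U V} hU hV := by
    refine ⟨by simp [hU.1, hV.1], by simp [hU.2.1, hV.2.1], ?_, ?_⟩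
    · simpa using add_mem hU.2.2.1 hV.2.2.1
    · simpa using add_mem hU.2.2.2 hV.2.2.2
  zero_mem' := by
    refine ⟨by simp, by simp, ?_, ?_⟩
    · rw [map_zero]; exact zero_mem (devGradGraph Ω).adjoint
    · rw [map_zero]; exact zero_mem (divDivGraph Ω)
  smul_mem' c U hU := by
    refine ⟨by simp [hU.1], by simp [hU.2.1], ?_, ?_⟩
    · simpa using (devGradGraph Ω).adjoint.smul_mem c hU.2.2.1
    · simpa using (divDivGraph Ω).smul_mem c hU.2.2.2

lemma isClosed_constraintSpace (hL : Dense ((L Ω).domain : Set (X Ω))) :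
    IsClosed (constraintSpace Ω : Set (X Ω)) := by
  have h : IsClosed ((devGradGraph Ω).adjoint : Set (L2 Ω TraceFree × L2 Ω Vec)) := by
    rw [← graph_devGradAdj hL]
    exact LinearPMap.adjoint_isClosed (dense_domain_devGrad hL)
  exact (isClosed_eq X.continuous_c₀ continuous_const).inter
    ((isClosed_eq X.continuous_c₃ continuous_const).inter
    ((h.preimage (X.continuous_c₁.prodMk continuous_const)).inter
    (isClosed_divDivGraph.preimage (X.continuous_c₂.prodMk continuous_const))))

/-- The range of `(sym curl)*` is divergence free. -/
lemma symCurlGraph_adjoint_comp {B : L2 Ω Symm} {A : L2 Ω TraceFree}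
    (h : (B, A) ∈ (symCurlGraph Ω).adjoint) : (A, (0 : L2 Ω Vec)) ∈ (devGradGraph Ω).adjoint := by
  rw [Submodule.mem_adjoint_iff] at h ⊢
  intro a b hab
  have := h b 0 (devGradGraph_comp hab)
  simpa using this

/-- With `T` the operator of graph `g`, the hypotheses combine to `u = -h² T*T u`, so `‖u‖² = -h² ‖T
u‖²`. -/
lemma eq_zero_of_adjoint_add_smul_mem {E F : Type*} [NormedAddCommGroup E] [InnerProductSpace ℝ E]
    [NormedAddCommGroup F] [InnerProductSpace ℝ F] {g : Submodule ℝ (E × F)} {u v : E} {a A : F}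
    {h : ℝ} (hua : (u, a) ∈ g) (hAv : (A, v) ∈ g.adjoint) (huv : u = h • v)
    (hA : (A + h • a, (0 : E)) ∈ g.adjoint) : u = 0 := by
  have h1 := (Submodule.mem_adjoint_iff _ _).1 hAv _ _ hua
  have h2 := (Submodule.mem_adjoint_iff _ _).1 hA _ _ hua
  simp only [inner_add_right, inner_smul_right, inner_zero_right] at h1 h2
  have h3 : ⟪u, u⟫_ℝ = h * ⟪u, v⟫_ℝ := by
    conv_lhs => rw [huv, inner_smul_right, ← huv]
  have h4 : ⟪u, u⟫_ℝ = -(h ^ 2 * ⟪a, a⟫_ℝ) := by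
    rw [h3]; linear_combination (-h) * h1 + h * h2
  refine (inner_self_eq_zero (𝕜 := ℝ)).1 (le_antisymm ?_ real_inner_self_nonneg)
  rw [h4, neg_nonpos]
  exact mul_nonneg (sq_nonneg h) real_inner_self_nonneg

/-- The dual situation: `c = -h² T T* c`, so `‖c‖² = -h² ‖T* c‖²`. -/
lemma eq_zero_of_sub_smul_adjoint_mem {E F : Type*} [NormedAddCommGroup E] [InnerProductSpace ℝ E]
    [NormedAddCommGroup F] [InnerProductSpace ℝ F] {g : Submodule ℝ (E × F)} {b B : E} {c w : F}
    {h : ℝ} (hBw : (B, -w) ∈ g) (hcb : (c, b) ∈ g.adjoint) (hcw : c = h • w)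
    (hB : (B - h • b, (0 : F)) ∈ g) : c = 0 := by
  have h1 := (Submodule.mem_adjoint_iff _ _).1 hcb _ _ hBw
  have h2 := (Submodule.mem_adjoint_iff _ _).1 hcb _ _ hB
  simp only [inner_sub_left, real_inner_smul_left, inner_zero_left, inner_neg_left] at h1 h2
  have h3 : ⟪c, c⟫_ℝ = h * ⟪w, c⟫_ℝ := by
    conv_lhs => rw [hcw, real_inner_smul_left, ← hcw]
  have h4 : ⟪c, c⟫_ℝ = -(h ^ 2 * ⟪b, b⟫_ℝ) := by
    rw [h3]; linear_combination (-h) * h1 + h * h2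
  refine (inner_self_eq_zero (𝕜 := ℝ)).1 (le_antisymm ?_ real_inner_self_nonneg)
  rw [h4, neg_nonpos]
  exact mul_nonneg (sq_nonneg h) real_inner_self_nonneg

/-- The constraints are preserved by the resolvents of `𝓛`. -/
lemma mem_constraintSpace_of_sub_smul_mem (hL : Dense ((L Ω).domain : Set (X Ω))) (h : ℝ)
    (hh : 0 < h) (p : X Ω × X Ω) (hp : p ∈ (L Ω).graph) (hY : p.1 - h • p.2 ∈ constraintSpace Ω) :
    p.1 ∈ constraintSpace Ω := by
  obtain ⟨U, V⟩ := p
  obtain ⟨a₁, b₁, a₂, b₂, h₀, h₁, h₂, h₃, h₄, h₅, h₆, h₇⟩ := (mem_graph_L_iff hL).1 hp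
  obtain ⟨y₀, y₃, y₁, y₂⟩ := hY
  simp only [map_sub, map_smul, h₆, h₇] at y₀ y₁ y₂ y₃
  rw [sub_eq_zero] at y₀ y₃
  have z₀ : X.c₀ U = 0 := by
    refine eq_zero_of_adjoint_add_smul_mem h₁ h₀ y₀ ?_
    -- The term `h b₁` lies in the range of `(sym curl)*`, is divergence free and can be dropped,
    -- leaving a condition on `c₁ U` and `a₁ = dev grad (c₀ U)` only.
    have k := add_mem y₁ ((devGradGraph Ω).adjoint.smul_mem (-h) (symCurlGraph_adjoint_comp h₂))
    convert k using 1
    refine Prod.ext ?_ (by simp)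
    simp only [Prod.fst_add, Prod.smul_fst]
    module
  have z₃ : X.c₃ U = 0 := by
    refine eq_zero_of_sub_smul_adjoint_mem h₅ h₄ y₃ ?_
    have k := sub_mem y₂ ((divDivGraph Ω).smul_mem (-h) (symCurlGraph_comp h₃))
    convert k using 1
    refine Prod.ext ?_ (by simp)
    simp only [Prod.fst_sub, Prod.smul_fst]
    module
  refine ⟨z₀, z₃, ?_, ?_⟩
  -- Once `c₀ U = 0`, the equation `c₀ U = h c₀ V` gives `c₀ V = 0`, which is the divergence
  -- constraint.
  · rw [z₀, eq_comm, smul_eq_zero] at y₀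
    simpa [y₀.resolve_left hh.ne'] using h₀
  · rw [z₃, eq_comm, smul_eq_zero] at y₃
    simpa [y₃.resolve_left hh.ne'] using h₅

end DivDiv

end

/-! ### Inverting `S`; Dirac solutions versus ADM solutions. -/

noncomputable section

namespace DivDiv

open scoped InnerProductSpace
open SkewGenerator

variable {Ω : Opens Vec}

section SInverse

/-- On symmetric matrices `S M = M - tr(M) I` and `tr(S M) = -2 tr M`, so `S² M = M + tr(M) I`.
Hence `S⁻¹ = (S + 1) / 2`. -/
lemma symmS_symmS_add (M : Symm) : symmS (symmS M) + symmS M = (2 : ℝ) • M := by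
  have h : ∀ N : Symm, (symmS N : Mat) = matS N := fun _ => rfl
  refine Subtype.ext ?_
  ext ⟨i, j⟩
  have hM : (M : Mat) (j, i) = (M : Mat) (i, j) := M.2 j i
  simp only [Submodule.coe_add, Submodule.coe_smul, h, PiLp.add_apply, PiLp.smul_apply, smul_eq_mul]
  simp only [matS, LinearMap.coe_mk, AddHom.coe_mk]
  by_cases hij : i = j
  · subst hij
    simp [Fin.sum_univ_three]
    ring
  · simp [hij, Ne.symm hij, hM]
    ring

lemma S_S_add (u : L2 Ω Symm) : S Ω (S Ω u) + S Ω u = (2 : ℝ) • u := by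
  refine Lp.ext ?_
  filter_upwards [Lp.coeFn_add (S Ω (S Ω u)) (S Ω u), Lp.coeFn_smul (2 : ℝ) u,
    symmS.coeFn_compLpL (p := 2) (S Ω u), symmS.coeFn_compLpL (p := 2) u] with x h1 h2 h3 h4
  have h3' : S Ω (S Ω u) x = symmS (S Ω u x) := h3
  have h4' : S Ω u x = symmS (u x) := h4
  rw [h1, h2, Pi.add_apply, Pi.smul_apply, h3', h4', symmS_symmS_add]

/-- The inverse of `S`. -/
def SInv (Ω : Opens Vec) : L2 Ω Symm →L[ℝ] L2 Ω Symm := (2⁻¹ : ℝ) • (S Ω + 1)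

lemma S_SInv (u : L2 Ω Symm) : S Ω (SInv Ω u) = u := by
  change S Ω ((2⁻¹ : ℝ) • (S Ω u + u)) = u
  rw [map_smul, map_add, S_S_add, inv_smul_smul₀ two_ne_zero]

lemma SInv_S (u : L2 Ω Symm) : SInv Ω (S Ω u) = u := by
  change (2⁻¹ : ℝ) • (S Ω (S Ω u) + S Ω u) = u
  rw [S_S_add, inv_smul_smul₀ two_ne_zero]

end SInverse

section Dirac

variable {T : ℝ} (hT : 0 < T)

lemma pmap_apply_eq {E F : Type*} [AddCommGroup E] [Module ℝ E] [AddCommGroup F] [Module ℝ F]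
    {f : E →ₗ.[ℝ] F} {x : E} {y : F} (h : (x, y) ∈ f.graph) (hx : x ∈ f.domain) : f ⟨x, hx⟩ = y :=
  ((LinearPMap.image_iff hx).2 h).symm

lemma isDiracSolution_of_graph {U₀ : X Ω} {U V : C(Icc 0 T, X Ω)}
    (hUV : ∀ t, (U t, V t) ∈ (L Ω).graph)
    (hder : ∀ t : Icc 0 T, HasDerivWithinAt (IccExtend hT.le U) (V t) (Icc 0 T) t)
    (h₀ : U ⟨0, left_mem_Icc.2 hT.le⟩ = U₀) : IsDiracSolution Ω hT U₀ U where
  mem_domain t := LinearPMap.mem_domain_of_mem_graph (hUV t)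
  continuous_L := V.continuous.congr fun t => (pmap_apply_eq (hUV t) _).symm
  hasDerivWithinAt t := by rw [pmap_apply_eq (hUV t)]; exact hder t
  initial := h₀

lemma inner_L_self (hL : Dense ((L Ω).domain : Set (X Ω))) (U : (L Ω).domain) :
    ⟪L Ω U, (U : X Ω)⟫_ℝ = 0 :=
  (isSkewGenerator_L hL).skew ((U : X Ω), L Ω U) (LinearPMap.mem_graph (L Ω) U)

lemma IsDiracSolution.norm_eq {hT : 0 < T} (hL : Dense ((L Ω).domain : Set (X Ω))) {U₀ : X Ω}
    {U : C(Icc 0 T, X Ω)} (hU : IsDiracSolution Ω hT U₀ U) (t : Icc 0 T) : ‖U t‖ = ‖U₀‖ := by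
  rw [norm_eq_of_inner_eq_zero hT hU.hasDerivWithinAt (fun t => ?_) t, hU.initial]
  exact inner_L_self hL ⟨U t, hU.mem_domain t⟩

lemma IsDiracSolution.unique {hT : 0 < T} (hL : Dense ((L Ω).domain : Set (X Ω))) {U₀ : X Ω}
    {U V : C(Icc 0 T, X Ω)} (hU : IsDiracSolution Ω hT U₀ U) (hV : IsDiracSolution Ω hT U₀ V) :
    U = V := by
  ext1 t
  have hskew : ∀ t, ⟪L Ω ⟨U t, hU.mem_domain t⟩ - L Ω ⟨V t, hV.mem_domain t⟩, (U - V) t⟫_ℝ = 0 :=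
    fun t => by
      have h := inner_L_self hL (⟨U t, hU.mem_domain t⟩ - ⟨V t, hV.mem_domain t⟩)
      rw [LinearPMap.map_sub] at h
      exact h
  have h := norm_eq_of_inner_eq_zero hT (u := U - V)
    (fun t => (hU.hasDerivWithinAt t).sub (hV.hasDerivWithinAt t)) hskew t
  rw [ContinuousMap.sub_apply, ContinuousMap.sub_apply, hU.initial, hV.initial, sub_self,
    norm_zero, norm_eq_zero] at h
  exact sub_eq_zero.1 h

/-- Membership in the domain of `𝓛` puts `A` in the domain of `(dev grad)*`; the weak divergence
then determines the value there. -/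
lemma mk_mem_constraintSpace (hL : Dense ((L Ω).domain : Set (X Ω))) {A : L2 Ω TraceFree}
    {B : L2 Ω Symm} (h : X.mk 0 A B 0 ∈ (L Ω).domain) (hA : div (matDist A) = 0)
    (hB : divdiv (matDist B) = 0) : X.mk 0 A B 0 ∈ constraintSpace Ω := by
  obtain ⟨a₁, b₁, a₂, b₂, h₀, -⟩ :=
    (mem_graph_L_iff hL).1 (LinearPMap.mem_graph (L Ω) ⟨_, h⟩)
  refine ⟨rfl, rfl, ?_, ?_⟩
  · rwa [eq_zero_of_div_eq_zero h₀ hA] at h₀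
  · change scalDist (0 : L2 Ω ℝ) = divdiv (matDist B)
    rw [hB, scalDist, map_zero]

/-- With the outer components zero, the `dev grad` and `(div div)*` terms of `𝓛` disappear. -/
lemma graph_L_of_mem_constraintSpace (hL : Dense ((L Ω).domain : Set (X Ω))) {U V : X Ω}
    (hUV : (U, V) ∈ (L Ω).graph) (hU : U ∈ constraintSpace Ω) :
    (X.c₂ U, -X.c₁ V) ∈ (symCurlAdj Ω).graph ∧ (X.c₁ U, X.c₂ V) ∈ (symCurl Ω).graph := by
  obtain ⟨a₁, b₁, a₂, b₂, -, h₁, h₂, h₃, h₄, -, h₆, h₇⟩ := (mem_graph_L_iff hL).1 hUV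
  obtain ⟨y₀, y₃, -, -⟩ := hU
  have ha₁ : a₁ = 0 := devGradGraph_single Ω _ h₁ y₀
  have hb₂ : b₂ = 0 := by
    -- The adjoint relation sends `0` only to `0` because the domain of `div div` is dense.
    refine (dense_domain_divDiv hL).eq_zero_of_inner_right ℝ fun w hw => ?_
    have := (Submodule.mem_adjoint_iff _ _).1 h₄ _ _
      (graph_divDiv (Ω := Ω) ▸ LinearPMap.mem_graph (divDiv Ω) ⟨w, hw⟩)
    simpa [y₃] using this
  rw [h₆, h₇, ha₁, hb₂, zero_add, neg_neg, add_zero, graph_symCurlAdj hL, graph_symCurl]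
  exact ⟨h₂, h₃⟩

/-- The components of a Dirac solution that satisfies the constraints solve the ADM system. -/
lemma isADMSolution_of_graph (hL : Dense ((L Ω).domain : Set (X Ω))) {U V : C(Icc 0 T, X Ω)}
    {A₀ : L2 Ω TraceFree} {γ₀ : L2 Ω Symm} (hUV : ∀ t, (U t, V t) ∈ (L Ω).graph)
    (hder : ∀ t : Icc 0 T, HasDerivWithinAt (IccExtend hT.le U) (V t) (Icc 0 T) t)
    (h₀ : U ⟨0, left_mem_Icc.2 hT.le⟩ = X.mk 0 A₀ (S Ω γ₀) 0) (hU : ∀ t, U t ∈ constraintSpace Ω)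
    {A : C(Icc 0 T, L2 Ω TraceFree)} {γ : C(Icc 0 T, L2 Ω Symm)} (hA : ∀ t, A t = X.c₁ (U t))
    (hγ : ∀ t, S Ω (γ t) = X.c₂ (U t)) : IsADMSolution Ω hT A₀ γ₀ A γ := by
  have hcurl : ∀ t, (S Ω (γ t), -X.c₁ (V t)) ∈ (symCurlAdj Ω).graph := fun t => by
    rw [hγ]; exact (graph_L_of_mem_constraintSpace hL (hUV t) (hU t)).1
  have hsymCurl : ∀ t, (A t, X.c₂ (V t)) ∈ (symCurl Ω).graph := fun t => by
    rw [hA]; exact (graph_L_of_mem_constraintSpace hL (hUV t) (hU t)).2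
  have hdiv : ∀ t, (A t, 0) ∈ (devGradAdj Ω).graph := fun t => by
    rw [hA, graph_devGradAdj hL]; exact (hU t).2.2.1
  have hdivdiv : ∀ t, (S Ω (γ t), 0) ∈ (divDiv Ω).graph := fun t => by
    rw [hγ, graph_divDiv]; exact (hU t).2.2.2
  let C₁ : X Ω →L[ℝ] L2 Ω TraceFree := ⟨X.c₁, X.continuous_c₁⟩
  let C₂ : X Ω →L[ℝ] L2 Ω Symm := ⟨X.c₂, X.continuous_c₂⟩
  exact
    { A_mem := fun t => LinearPMap.mem_domain_of_mem_graph (hsymCurl t)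
      A_mem_adjoint := fun t => LinearPMap.mem_domain_of_mem_graph (hdiv t)
      γ_mem := fun t => LinearPMap.mem_domain_of_mem_graph (hdivdiv t)
      γ_mem_adjoint := fun t => LinearPMap.mem_domain_of_mem_graph (hcurl t)
      continuous_symCurl := (X.continuous_c₂.comp V.continuous).congr fun t =>
        (pmap_apply_eq (hsymCurl t) _).symm
      continuous_curl := (X.continuous_c₁.comp V.continuous).neg.congr fun t =>
        (pmap_apply_eq (hcurl t) _).symm
      div_A := fun t => by rw [pmap_apply_eq (hdiv t), neg_zero]
      deriv_A := fun t => by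
        rw [pmap_apply_eq (hcurl t), neg_neg]
        have h : IccExtend hT.le A = C₁ ∘ IccExtend hT.le U := funext fun s => hA _
        rw [h]
        exact C₁.hasFDerivAt.comp_hasDerivWithinAt _ (hder t)
      deriv_γ := fun t => by
        rw [pmap_apply_eq (hsymCurl t)]
        have h : IccExtend hT.le (fun s => S Ω (γ s)) = C₂ ∘ IccExtend hT.le U :=
          funext fun s => hγ _
        rw [h]
        exact C₂.hasFDerivAt.comp_hasDerivWithinAt _ (hder t)
      divdiv_γ := fun t => pmap_apply_eq (hdivdiv t) _
      initial_A := by rw [hA, h₀, X.c₁_mk]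
      initial_γ := by rw [← SInv_S (γ _), hγ, h₀, X.c₂_mk, SInv_S] }

/-- Solutions of the ADM system are solutions of the Hodge-Dirac equation. -/
lemma IsADMSolution.isDiracSolution {hT : 0 < T} (hL : Dense ((L Ω).domain : Set (X Ω)))
    {A₀ : L2 Ω TraceFree} {γ₀ : L2 Ω Symm} {A : C(Icc 0 T, L2 Ω TraceFree)}
    {γ : C(Icc 0 T, L2 Ω Symm)} (h : IsADMSolution Ω hT A₀ γ₀ A γ) {U : C(Icc 0 T, X Ω)}
    (hU : ∀ t, U t = X.mk 0 (A t) (S Ω (γ t)) 0) :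
    IsDiracSolution Ω hT (X.mk 0 A₀ (S Ω γ₀) 0) U := by
  let V : C(Icc 0 T, X Ω) :=
    ⟨fun t => X.mk 0 (-symCurlAdj Ω ⟨S Ω (γ t), h.γ_mem_adjoint t⟩) (symCurl Ω ⟨A t, h.A_mem t⟩) 0,
      X.continuous_mk.comp (continuous_const.prodMk (h.continuous_curl.neg.prodMk
        (h.continuous_symCurl.prodMk continuous_const)))⟩
  refine isDiracSolution_of_graph hT (V := V) (fun t => ?_) (fun t => ?_) ?_
  · refine (mem_graph_L_iff hL).2 ⟨0, symCurlAdj Ω ⟨S Ω (γ t), h.γ_mem_adjoint t⟩,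
      symCurl Ω ⟨A t, h.A_mem t⟩, 0, ?_⟩
    rw [hU, ← graph_devGradAdj hL, ← graph_symCurlAdj hL, ← graph_symCurl]
    refine ⟨?_, zero_mem (devGradGraph Ω), LinearPMap.mem_graph (symCurlAdj Ω) ⟨_, _⟩,
      LinearPMap.mem_graph (symCurl Ω) ⟨_, _⟩, zero_mem (divDivGraph Ω).adjoint, ?_, ?_, ?_⟩
    · have h1 := LinearPMap.mem_graph (devGradAdj Ω) ⟨_, h.A_mem_adjoint t⟩
      rwa [neg_eq_zero.1 (h.div_A t)] at h1
    · have h1 := LinearPMap.mem_graph (divDiv Ω) ⟨_, h.γ_mem t⟩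
      rw [h.divdiv_γ t] at h1
      change (S Ω (γ t), -(0 : L2 Ω ℝ)) ∈ divDivGraph Ω
      rwa [neg_zero, ← graph_divDiv]
    · rw [zero_add]; rfl
    · rw [add_zero]; rfl
  · let M : (L2 Ω Vec × L2 Ω TraceFree × L2 Ω Symm × L2 Ω ℝ) →L[ℝ] X Ω :=
      ⟨{ toFun := fun p => X.mk p.1 p.2.1 p.2.2.1 p.2.2.2
         map_add' := fun _ _ => rfl
         map_smul' := fun _ _ => rfl }, X.continuous_mk⟩
    have h1 : IccExtend hT.le U = M ∘ fun s => ((0 : L2 Ω Vec), IccExtend hT.le A s,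
        IccExtend hT.le (fun s => S Ω (γ s)) s, (0 : L2 Ω ℝ)) := funext fun s => hU _
    rw [h1]
    exact M.hasFDerivAt.comp_hasDerivWithinAt _ ((hasDerivWithinAt_const _ _ _).prodMk
      ((h.deriv_A t).prodMk ((h.deriv_γ t).prodMk (hasDerivWithinAt_const _ _ _))))
  · rw [hU, h.initial_A, h.initial_γ]

end Dirac

end DivDiv

end

/-! ### Well-posedness of the Dirac equation and of the ADM system. -/

theorem mainTheorem2 (Ω : TopologicalSpace.Opens DivDiv.Vec)
    (hdense : Dense ((DivDiv.L Ω).domain : Set (DivDiv.X Ω)))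
    (T : ℝ) (hT : 0 < T)
    (l₀ : DivDiv.L2 Ω DivDiv.Vec) (A₀ : DivDiv.L2 Ω DivDiv.TraceFree)
    (γ₀ : DivDiv.L2 Ω DivDiv.Symm) (l₃ : DivDiv.L2 Ω ℝ)
    (hinit : DivDiv.X.mk l₀ A₀ (DivDiv.S Ω γ₀) l₃ ∈ (DivDiv.L Ω).domain) :
    ∃ U : C(Set.Icc 0 T, DivDiv.X Ω),
      DivDiv.IsDiracSolution Ω hT (DivDiv.X.mk l₀ A₀ (DivDiv.S Ω γ₀) l₃) U ∧
      (∀ V : C(Set.Icc 0 T, DivDiv.X Ω),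
        DivDiv.IsDiracSolution Ω hT (DivDiv.X.mk l₀ A₀ (DivDiv.S Ω γ₀) l₃) V → V = U) ∧
      ‖U‖ ≤ ‖DivDiv.X.mk l₀ A₀ (DivDiv.S Ω γ₀) l₃‖ ∧
      (l₀ = 0 → l₃ = 0 → DivDiv.div (DivDiv.matDist A₀) = 0 →
        DivDiv.divdiv (DivDiv.matDist (DivDiv.S Ω γ₀)) = 0 →
        ∃ (A : C(Set.Icc 0 T, DivDiv.L2 Ω DivDiv.TraceFree))
          (γ : C(Set.Icc 0 T, DivDiv.L2 Ω DivDiv.Symm)),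
          (∀ t, U t = DivDiv.X.mk 0 (A t) (DivDiv.S Ω (γ t)) 0) ∧
          DivDiv.IsADMSolution Ω hT A₀ γ₀ A γ ∧
          ∀ (B : C(Set.Icc 0 T, DivDiv.L2 Ω DivDiv.TraceFree))
            (η : C(Set.Icc 0 T, DivDiv.L2 Ω DivDiv.Symm)),
            DivDiv.IsADMSolution Ω hT A₀ γ₀ B η → B = A ∧ η = γ) := by
  obtain ⟨U, V, hUV, hder, h0, hinv⟩ := (DivDiv.isSkewGenerator_L hdense).exists_solution hT
    (LinearPMap.mem_graph (DivDiv.L Ω) ⟨_, hinit⟩)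
  have hU := DivDiv.isDiracSolution_of_graph hT hUV hder h0
  refine ⟨U, hU, fun V hV => hV.unique hdense hU,
    (ContinuousMap.norm_le _ (norm_nonneg _)).2 fun t => (hU.norm_eq hdense t).le, ?_⟩
  rintro rfl rfl hA hγ
  have hY := hinv _ (DivDiv.isClosed_constraintSpace hdense)
    (DivDiv.mem_constraintSpace_of_sub_smul_mem hdense)
    (DivDiv.mk_mem_constraintSpace hdense hinit hA hγ)
  refine ⟨⟨fun t => DivDiv.X.c₁ (U t), DivDiv.X.continuous_c₁.comp U.continuous⟩,
    ⟨fun t => DivDiv.SInv Ω (DivDiv.X.c₂ (U t)),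
      (DivDiv.SInv Ω).continuous.comp (DivDiv.X.continuous_c₂.comp U.continuous)⟩,
    fun t => ?_, ?_, fun B η hB => ?_⟩
  · exact DivDiv.X.ext (hY t).1 rfl (DivDiv.S_SInv _).symm (hY t).2.1
  · exact DivDiv.isADMSolution_of_graph hT hdense hUV hder h0 hY (fun _ => rfl)
      fun _ => DivDiv.S_SInv _
  -- Uniqueness for ADM: padding the competitor with zeros gives a Dirac solution with the same
  -- initial value, hence `U`; then `S` is inverted.
  · have hc : Continuous fun t => DivDiv.X.mk (0 : DivDiv.L2 Ω DivDiv.Vec) (B t)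
        (DivDiv.S Ω (η t)) (0 : DivDiv.L2 Ω ℝ) :=
      DivDiv.X.continuous_mk.comp (continuous_const.prodMk (B.continuous.prodMk
        (((DivDiv.S Ω).continuous.comp η.continuous).prodMk continuous_const)))
    have hBU := (hB.isDiracSolution hdense (U := ⟨_, hc⟩) fun _ => rfl).unique hdense hU
    have hBU' : ∀ t, DivDiv.X.mk 0 (B t) (DivDiv.S Ω (η t)) 0 = U t := fun t =>
      DFunLike.congr_fun hBU t
    refine ⟨ContinuousMap.ext fun t => congrArg DivDiv.X.c₁ (hBU' t), ContinuousMap.ext fun t => ?_⟩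
    have h1 : DivDiv.S Ω (η t) = DivDiv.X.c₂ (U t) := congrArg DivDiv.X.c₂ (hBU' t)
    rw [← DivDiv.SInv_S (η t), h1]
    rfl
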